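/- Let $M$ be a simply connected oriented smooth manifold (possibly with boundary), let $K\subset M$ be an oriented, properly embedded smooth submanifold of codimension $2$ (with $\partial K=K\cap\partial M$, the intersection being transverse), and let $p\in M\setminus K$. Let $N\subset\mathbb C$ be the noose, i.e. the union of the closed unit disk and the real segment $[1,2]$. A noose in $(M,K,p)$ is a continuous map $\nu:N\to M$ with $\nu(2)=p$ and $\nu^{-1}(K)=\{0\}$. Let $Q(M,K,p)$ (the underlying set of the knot quandle) be the set of homotopy classes, where homotopies are through nooses in $(M,K,p)$, of those nooses $\nu$ whose bounding circle $\nu|_{S^1}$ has signed linking number $1$ with $K$, i.e. for which the local intersection number at $0$ of the disk of $\nu$ with $K$ is $+1$. Let the augmentation $\ell:Q(M,K,p)\to\pi_1(M\setminus K,p)$ send the class of $\nu$ to the homotopy class of its canonical loop, which traverses the arc $\nu([1,2])$ from $p$, then $\nu(S^1)$ counterclockwise, then the arc back to $p$. Then the image $\ell(Q(M,K,p))$ generates the group $\pi_1(M\setminus K,p)$. -/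

import Mathlib

open scoped Manifold ContDiff Topology unitInterval

noncomputable section

namespace KnotQuandle

/-! ### Nooses in a pointed pair -/

/-- The noose `N ⊆ ℂ`: the union of the closed unit disk and the real segment `[1, 2]`. -/
def nooseSet : Set ℂ := Metric.closedBall 0 1 ∪ segment ℝ 1 2

/-- The noose as a topological space. -/
abbrev NooseSpace : Type := nooseSet

/-- The distinguished point `0` of the noose (its distinguished subspace is `{0}`). -/
def NooseSpace.center : NooseSpace := ⟨0, Or.inl (by simp)⟩

/-- The base point `2` of the noose. -/
def NooseSpace.base : NooseSpace := ⟨2, Or.inr (right_mem_segment ℝ 1 2)⟩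

/-- The point `r * exp (2 π i t)` of the disk of the noose. -/
def NooseSpace.diskPoint (r t : I) : NooseSpace :=
  ⟨(r : ℝ) * Complex.exp (2 * Real.pi * Complex.I * (t : ℝ)), Or.inl (by
    have h : ‖Complex.exp (2 * Real.pi * Complex.I * (t : ℝ))‖ = 1 := by
      have := Complex.norm_exp_ofReal_mul_I (2 * Real.pi * t)
      rw [← this]
      congr 2
      push_cast
      ring
    have h0 : |(r : ℝ)| = r := abs_of_nonneg r.2.1
    simpa [h, h0] using r.2.2)⟩

/-- The point `2 - t` of the segment `[1, 2]` of the noose. -/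
def NooseSpace.arcPoint (t : I) : NooseSpace :=
  ⟨((2 - t : ℝ) : ℂ), Or.inr ⟨t, 1 - t, t.2.1, by linarith [t.2.2], by ring, by
    simp only [Complex.real_smul]
    push_cast
    ring⟩⟩

lemma NooseSpace.continuous_diskPoint (r : I) :
    Continuous (NooseSpace.diskPoint r) := by
  unfold NooseSpace.diskPoint
  fun_prop

lemma NooseSpace.continuous_arcPoint : Continuous NooseSpace.arcPoint := by
  unfold NooseSpace.arcPoint
  fun_prop

lemma NooseSpace.arcPoint_zero : NooseSpace.arcPoint 0 = NooseSpace.base := by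
  ext
  simp [NooseSpace.arcPoint, NooseSpace.base]

lemma NooseSpace.diskPoint_one_zero :
    NooseSpace.diskPoint 1 0 = NooseSpace.arcPoint 1 := by
  ext
  simp [NooseSpace.arcPoint, NooseSpace.diskPoint]
  norm_num

lemma NooseSpace.diskPoint_one_one :
    NooseSpace.diskPoint 1 1 = NooseSpace.arcPoint 1 := by
  ext
  simp [NooseSpace.arcPoint, NooseSpace.diskPoint, Complex.exp_two_pi_mul_I]
  norm_num

lemma NooseSpace.arcPoint_ne_center (t : I) : NooseSpace.arcPoint t ≠ NooseSpace.center := by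
  intro h
  have h' : ((2 - t : ℝ) : ℂ) = 0 := congrArg Subtype.val h
  have h'' : (2 - t : ℝ) = 0 := by exact_mod_cast h'
  linarith [t.2.2]

lemma NooseSpace.diskPoint_one_ne_center (t : I) :
    NooseSpace.diskPoint 1 t ≠ NooseSpace.center := by
  intro h
  have h' := congrArg Subtype.val h
  simp [NooseSpace.diskPoint, NooseSpace.center] at h'

section Pair

variable {X : Type*} [TopologicalSpace X]

/-- `ν` is a map of pointed pairs from `(N, {0}, 2)` to `(X, S, p)`: it preserves the base point,
the subspace and the complement of the subspace. -/
def IsNoose (S : Set X) (p : X) (ν : C(NooseSpace, X)) : Prop :=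
  ν NooseSpace.base = p ∧ ∀ z, ν z ∈ S ↔ z = NooseSpace.center

/-- The maps of pointed pairs from the noose `(N, {0}, 2)` to `(X, S, p)`. -/
def Noose (S : Set X) (p : X) : Type _ := {ν : C(NooseSpace, X) // IsNoose S p ν}

/-- Homotopy of nooses, through maps of pointed pairs. -/
def nooseSetoid (S : Set X) (p : X) : Setoid (Noose S p) where
  r ν μ := ContinuousMap.HomotopicWith ν.1 μ.1 (IsNoose S p)
  iseqv :=
    { refl := fun ν => ContinuousMap.HomotopicWith.refl ν.1 ν.2
      symm := fun h => ContinuousMap.HomotopicWith.symm h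
      trans := fun h₁ h₂ => ContinuousMap.HomotopicWith.trans h₁ h₂ }

/-- The underlying set of the fundamental quandle `Π(X, S, p)`: homotopy classes of nooses. -/
def FundamentalQuandle (S : Set X) (p : X) : Type _ := Quotient (nooseSetoid S p)

/-- The class of a noose in the fundamental quandle. -/
def FundamentalQuandle.mk {S : Set X} {p : X} (ν : Noose S p) : FundamentalQuandle S p :=
  Quotient.mk (nooseSetoid S p) ν

variable {S : Set X} {p : X}

/-- The value of a noose away from its center, as a point of the complement. -/
def Noose.eval (ν : Noose S p) (z : NooseSpace) (hz : z ≠ NooseSpace.center) : (Sᶜ : Set X) :=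
  ⟨ν.1 z, fun h => hz ((ν.2.2 z).1 h)⟩

/-- The arc of a noose, traversed from the base point `p`, as a path in the complement. -/
def Noose.arc (hp : p ∉ S) (ν : Noose S p) :
    Path (⟨p, hp⟩ : (Sᶜ : Set X))
      (ν.eval (NooseSpace.arcPoint 1) (NooseSpace.arcPoint_ne_center 1)) where
  toFun t := ν.eval (NooseSpace.arcPoint t) (NooseSpace.arcPoint_ne_center t)
  continuous_toFun := (ν.1.continuous.comp NooseSpace.continuous_arcPoint).subtype_mk _
  source' := by
    ext
    simp only [Noose.eval, NooseSpace.arcPoint_zero]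
    exact ν.2.1
  target' := rfl

/-- The bounding circle of a noose, traversed counterclockwise from the point `1`, as a loop in
the complement. -/
def Noose.circle (ν : Noose S p) :
    Path (ν.eval (NooseSpace.arcPoint 1) (NooseSpace.arcPoint_ne_center 1))
      (ν.eval (NooseSpace.arcPoint 1) (NooseSpace.arcPoint_ne_center 1)) where
  toFun t := ν.eval (NooseSpace.diskPoint 1 t) (NooseSpace.diskPoint_one_ne_center t)
  continuous_toFun := (ν.1.continuous.comp (NooseSpace.continuous_diskPoint 1)).subtype_mk _
  source' := by simp only [NooseSpace.diskPoint_one_zero]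
  target' := by simp only [NooseSpace.diskPoint_one_one]

/-- The canonical loop of a noose: it traverses the arc, then the boundary of the disk
counterclockwise, then the arc back to `p`. -/
def Noose.canonicalLoop (hp : p ∉ S) (ν : Noose S p) :
    Path (⟨p, hp⟩ : (Sᶜ : Set X)) ⟨p, hp⟩ :=
  ((ν.arc hp).trans ν.circle).trans (ν.arc hp).symm

lemma Noose.canonicalLoop_homotopic (hp : p ∉ S) {ν μ : Noose S p}
    (h : ContinuousMap.HomotopicWith ν.1 μ.1 (IsNoose S p)) :
    (ν.canonicalLoop hp).Homotopic (μ.canonicalLoop hp) := by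
  obtain ⟨F⟩ := h
  let N : I → Noose S p := fun s => ⟨_, F.prop' s⟩
  have hN : ∀ s z, (N s).1 z = F (s, z) := fun _ _ => rfl
  have hN0 : N 0 = ν := Subtype.ext (ContinuousMap.ext fun z => F.apply_zero z)
  have hN1 : N 1 = μ := Subtype.ext (ContinuousMap.ext fun z => F.apply_one z)
  have harc : Continuous ↿fun s => (N s).arc hp := by
    refine Continuous.subtype_mk (f := fun q : I × I => F (q.1, NooseSpace.arcPoint q.2)) ?_ _
    exact F.continuous.comp
      (continuous_fst.prodMk (NooseSpace.continuous_arcPoint.comp continuous_snd))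
  have hcirc : Continuous ↿fun s => (N s).circle := by
    refine Continuous.subtype_mk (f := fun q : I × I => F (q.1, NooseSpace.diskPoint 1 q.2)) ?_ _
    exact F.continuous.comp
      (continuous_fst.prodMk ((NooseSpace.continuous_diskPoint 1).comp continuous_snd))
  have hloop : Continuous ↿fun s => (N s).canonicalLoop hp :=
    Path.trans_continuous_family _ (Path.trans_continuous_family _ harc _ hcirc) _
      (Path.symm_continuous_family _ harc)
  refine ⟨{ toFun := fun q => (N q.1).canonicalLoop hp q.2
            continuous_toFun := hloop
            map_zero_left := fun t => by rw [hN0]; rfl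
            map_one_left := fun t => by rw [hN1]; rfl
            prop' := ?_ }⟩
  intro s t ht
  rcases ht with rfl | rfl
  · simp
  · simp

/-- The augmentation `ℓ`: the class of a noose is sent to the homotopy class of its canonical
loop in the complement. -/
def augmentation (S : Set X) (p : X) (hp : p ∉ S) (q : FundamentalQuandle S p) :
    FundamentalGroup (Sᶜ : Set X) ⟨p, hp⟩ :=
  Quotient.lift (s := nooseSetoid S p)
    (fun ν => FundamentalGroup.fromPath (Path.Homotopic.Quotient.mk (ν.canonicalLoop hp)))
    (fun _ _ h => Path.Homotopic.Quotient.eq.2 (Noose.canonicalLoop_homotopic hp h)) q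

end Pair

/-! ### Oriented manifolds and linking numbers -/

/-- The model `J` describes manifolds with (possibly empty) boundary: its range is the whole model
vector space (the case `a = 0`) or a closed half-space. -/
def IsBoundaryModel {E H : Type*} [NormedAddCommGroup E] [NormedSpace ℝ E] [TopologicalSpace H]
    (J : ModelWithCorners ℝ E H) : Prop :=
  ∃ a : E →L[ℝ] ℝ, Set.range J = {x | 0 ≤ a x}

/-- An orientation of an `n`-dimensional smooth manifold: an orientation of every tangent space
that is locally constant in the standard trivializations of the tangent bundle. -/
structure ManifoldOrientation {n : ℕ} {H : Type*} [TopologicalSpace H]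
    (J : ModelWithCorners ℝ (EuclideanSpace ℝ (Fin n)) H)
    (M : Type*) [TopologicalSpace M] [ChartedSpace H M] [IsManifold J ∞ M] where
  /-- the orientation of the tangent space at a point -/
  at_ : ∀ x : M, Orientation ℝ (TangentSpace J x) (Fin n)
  /-- continuity of the orientation -/
  locally_constant : ∀ x : M, ∃ s : Orientation ℝ (EuclideanSpace ℝ (Fin n)) (Fin n),
    ∀ᶠ y in 𝓝 x, ∀ hy : y ∈ (trivializationAt (EuclideanSpace ℝ (Fin n))
        (TangentSpace J : M → Type _) x).baseSet,
      Orientation.map (Fin n) ((trivializationAt (EuclideanSpace ℝ (Fin n))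
        (TangentSpace J : M → Type _) x).linearEquivAt ℝ y hy) (at_ y) = s

/-- The family `v` is a basis that represents the orientation `o`. -/
def IsPositiveBasis {V : Type*} [AddCommGroup V] [Module ℝ V] {n : ℕ}
    (o : Orientation ℝ V (Fin n)) (v : Fin n → V) : Prop :=
  ∃ b : Module.Basis (Fin n) ℝ V, ⇑b = v ∧ b.orientation = o

/-- `γ : [0, 1] → ℂ` is a closed curve avoiding `0` with winding number `w` about `0`: it has a
continuous logarithm that increases by `2 π i w`. -/
def HasWindingNumber (γ : I → ℂ) (w : ℤ) : Prop :=
  ∃ θ : C(I, ℂ), (∀ t, Complex.exp (θ t) = γ t) ∧ θ 1 - θ 0 = 2 * Real.pi * Complex.I * w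

section Linking

variable {m : ℕ} {H H' : Type*} [TopologicalSpace H] [TopologicalSpace H']
  {J : ModelWithCorners ℝ (EuclideanSpace ℝ (Fin (m + 2))) H}
  {J' : ModelWithCorners ℝ (EuclideanSpace ℝ (Fin m)) H'}
  {M : Type*} [TopologicalSpace M] [ChartedSpace H M] [IsManifold J ∞ M]
  {K : Type*} [TopologicalSpace K] [ChartedSpace H' K] [IsManifold J' ∞ K]

/-- `K`, included in `M` by `f`, is a properly embedded codimension 2 submanifold: `f` is a smooth
embedding, is proper, and satisfies `∂K = K ∩ ∂M`. -/
structure IsProperlyEmbedded (J : ModelWithCorners ℝ (EuclideanSpace ℝ (Fin (m + 2))) H)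
    (J' : ModelWithCorners ℝ (EuclideanSpace ℝ (Fin m)) H') (f : K → M) : Prop where
  isSmoothEmbedding : Manifold.IsSmoothEmbedding J' J ∞ f
  isProperMap : IsProperMap f
  boundary_iff : ∀ k : K, f k ∈ J.boundary M ↔ k ∈ J'.boundary K

/-- `g : M → ℂ` is, on the open neighbourhood `U` of the point `f k` of `K`, an equation of `K`
in `M` that is compatible with the orientations: `g` is smooth on `U`, vanishes there exactly on
`K`, its differential at `f k` is onto, and the isomorphism of the normal space `T M / T K` at
`f k` with `ℂ` that it induces preserves orientations. Here the normal space is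
oriented so that an oriented basis of `T K` followed by an oriented basis of the normal
space is an oriented basis of `T M` (codimension 2 makes the order of the two irrelevant). -/
structure IsOrientedEquation (oM : ManifoldOrientation J M) (oK : ManifoldOrientation J' K)
    (f : K → M) (k : K) (U : Set M) (g : M → ℂ) : Prop where
  isOpen : IsOpen U
  mem : f k ∈ U
  smooth : ContMDiffOn J 𝓘(ℝ, ℂ) ∞ g U
  zero_iff : ∀ y ∈ U, g y = 0 ↔ y ∈ Set.range f
  surjective : Function.Surjective (mfderiv J 𝓘(ℝ, ℂ) g (f k))
  oriented : ∀ (b : Module.Basis (Fin m) ℝ (TangentSpace J' k)) (v₁ v₂ : TangentSpace J (f k)),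
    mfderiv J 𝓘(ℝ, ℂ) g (f k) v₁ = (1 : ℂ) → mfderiv J 𝓘(ℝ, ℂ) g (f k) v₂ = Complex.I →
      (IsPositiveBasis (oK.at_ k) b ↔
        IsPositiveBasis (oM.at_ (f k)) (Fin.append (fun i => mfderiv J' J f k (b i)) ![v₁, v₂]))

/-- The bounding circle of the noose `ν` has (signed) linking number `w` with `K`. As the disk of
the noose meets `K` only in the image of its center, this is the local intersection number
there of the disk with `K`: the winding number about `0` of the image of a small circle
around the center under an oriented equation of `K`. -/
def HasLinkingNumber (oM : ManifoldOrientation J M) (oK : ManifoldOrientation J' K)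
    (f : K → M) {p : M} (ν : Noose (Set.range f) p) (w : ℤ) : Prop :=
  ∃ (k : K) (U : Set M) (g : M → ℂ), f k = ν.1 NooseSpace.center ∧
    IsOrientedEquation oM oK f k U g ∧
    ∃ r : I, 0 < r ∧ (∀ z : NooseSpace, ‖(z : ℂ)‖ ≤ r → ν.1 z ∈ U) ∧
      HasWindingNumber (fun t => g (ν.1 (NooseSpace.diskPoint r t))) w

/-- The underlying set of the knot quandle `Q(M, K, p)`, a subset of the fundamental quandle
`Π(M, K, p)`: the classes of nooses whose bounding circle has linking number `1` with `K`. -/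
def knotQuandle (oM : ManifoldOrientation J M) (oK : ManifoldOrientation J' K)
    (f : K → M) (p : M) : Set (FundamentalQuandle (Set.range f) p) :=
  {q | ∃ ν : Noose (Set.range f) p,
    FundamentalQuandle.mk ν = q ∧ HasLinkingNumber oM oK f ν 1}

end Linking

end KnotQuandle

end

/-! Filling `K` back into its complement kills exactly the meridians, and what remains is the
trivial group of `M`; so the meridians generate the group of the complement as a normal subgroup.
They also generate it as a subgroup: conjugating the canonical loop of a noose only changes the arc
of the noose, and every arc to a meridian gives an element of the quandle (`conj_mul_conj_inv`).

The filling argument replaces van Kampen's theorem or a general position disk by a descent argument.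
Let `N` be the normal closure of meridian loops. Joining all points of the complement to `p` yields
a multiplicative, homotopy invariant function on the paths of the complement, with values in the
quotient by `N` (`quotientCocycle`). Off `K`, it is trivial on loops inside a convex chart. Near a
point of `K`, logarithmic polar coordinates in a slice chart show that the value on one meridian
determines the value on every loop (`IsSliceChart.trivialOver`), and meridians have value 1 by the
choice of `N`. Over a simply connected space, local triviality implies triviality
(`PathCocycle.val_eq_one_of_locally_trivial`): local potentials differ by locally constant
functions, which are the transition functions of a covering, and a section of the covering glues the
potentials. Hence the quotient is trivial.

The geometric input is `exists_meridian_neighbourhood`. Transversality at the boundary is not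
assumed: it follows from `boundary_iff` (`interior_or_transverse`), and it allows meridian disks
parallel to the boundary. The sign of the linking number is arranged by composing the linear
equation of the slice with complex conjugation if necessary (`exists_sign_oriented`). -/

noncomputable section

namespace KnotQuandle

/-! ### Path cocycles and their triviality over simply connected spaces. -/

section Cocycle

open Set Filter

/-- A homotopy invariant, multiplicative function on the paths of `A` with values in a group. -/
structure PathCocycle (A Γ : Type*) [TopologicalSpace A] [Group Γ] where
  /-- the value on a path -/
  val : ∀ {a b : A}, Path a b → Γ
  val_trans : ∀ {a b c : A} (α : Path a b) (β : Path b c), val (α.trans β) = val α * val β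
  val_homotopic : ∀ {a b : A} {α β : Path a b}, α.Homotopic β → val α = val β

namespace PathCocycle

variable {A Γ : Type*} [TopologicalSpace A] [Group Γ] (F : PathCocycle A Γ)

lemma val_refl (a : A) : F.val (Path.refl a) = 1 := by
  have h := F.val_trans (Path.refl a) (Path.refl a)
  rw [Path.refl_trans_refl] at h
  simpa using h

lemma val_symm {a b : A} (α : Path a b) : F.val α.symm = (F.val α)⁻¹ := by
  have h := F.val_homotopic (⟨Path.Homotopy.reflTransSymm α⟩ : Path.Homotopic _ _)
  rw [F.val_trans, F.val_refl] at h
  exact (inv_eq_of_mul_eq_one_right h.symm).symm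

lemma val_cast {a b a' b' : A} (α : Path a b) (h : a' = a) (h' : b' = b) :
    F.val (α.cast h h') = F.val α := by
  subst h h'
  rfl

lemma val_subpath_mul {a b : A} (α : Path a b) (r s t : I) :
    F.val (α.subpath r s) * F.val (α.subpath s t) = F.val (α.subpath r t) := by
  rw [← F.val_trans]
  exact F.val_homotopic ⟨Path.Homotopy.subpathTransSubpath α r s t⟩

variable {X : Type*} (i : A → X)

/-- The preimage of `V` is nonempty and path connected. -/
def PreimagePathConnected (i : A → X) (V : Set X) : Prop :=
  (i ⁻¹' V).Nonempty ∧ ∀ a b, i a ∈ V → i b ∈ V → ∃ γ : Path a b, ∀ t, i (γ t) ∈ V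

/-- The cocycle is trivial on the loops in the preimage of `V`. -/
def TrivialOver (V : Set X) : Prop :=
  ∀ (a : A) (γ : Path a a), (∀ t, i (γ t) ∈ V) → F.val γ = 1

variable {i} {F}

lemma TrivialOver.eq {V : Set X} (hV : F.TrivialOver i V) {a b : A} (α β : Path a b)
    (hα : ∀ t, i (α t) ∈ V) (hβ : ∀ t, i (β t) ∈ V) : F.val α = F.val β := by
  have h := hV a (α.trans β.symm) (fun t => by
    have ht := mem_range_self (f := α.trans β.symm) t
    rw [Path.trans_range, Path.symm_range] at ht
    rcases ht with ⟨s, hs⟩ | ⟨s, hs⟩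
    · rw [← hs]; exact hα s
    · rw [← hs]; exact hβ s)
  rwa [F.val_trans, F.val_symm, mul_inv_eq_one] at h

/-- `τ` is a potential of the cocycle over `V`. -/
def IsPotential (F : PathCocycle A Γ) (i : A → X) (V : Set X) (τ : A → Γ) : Prop :=
  ∀ (a b : A) (α : Path a b), (∀ t, i (α t) ∈ V) → τ a * F.val α = τ b

lemma IsPotential.mono {V W : Set X} {τ : A → Γ} (h : F.IsPotential i V τ) (hW : W ⊆ V) :
    F.IsPotential i W τ := fun a b α hα => h a b α fun t => hW (hα t)

lemma TrivialOver.exists_isPotential {V : Set X} (hV : F.TrivialOver i V)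
    (hc : PreimagePathConnected i V) : ∃ τ, F.IsPotential i V τ := by
  classical
  obtain ⟨⟨c, hcV⟩, hj⟩ := hc
  choose γ hγ using fun a (ha : i a ∈ V) => hj c a hcV ha
  refine ⟨fun a => if ha : i a ∈ V then F.val (γ a ha) else 1, fun a b α hα => ?_⟩
  have ha : i a ∈ V := by simpa using hα 0
  have hb : i b ∈ V := by simpa using hα 1
  simp only [ha, hb, dif_pos]
  rw [← F.val_trans]
  refine hV.eq _ _ (fun t => ?_) (hγ b hb)
  have ht := mem_range_self (f := (γ a ha).trans α) t
  rw [Path.trans_range] at ht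
  rcases ht with ⟨s, hs⟩ | ⟨s, hs⟩
  · rw [← hs]; exact hγ a ha s
  · rw [← hs]; exact hα s

/-- Along a path over `V` both potentials are multiplied on the right by the same value, which
cancels in the quotient. So potentials are unique up to left multiplication by a constant. -/
lemma IsPotential.div_eq {V : Set X} (hc : PreimagePathConnected i V) {ρ τ : A → Γ}
    (hρ : F.IsPotential i V ρ) (hτ : F.IsPotential i V τ) {a b : A} (ha : i a ∈ V)
    (hb : i b ∈ V) : ρ a * (τ a)⁻¹ = ρ b * (τ b)⁻¹ := by
  obtain ⟨γ, hγ⟩ := hc.2 a b ha hb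
  rw [← hρ a b γ hγ, ← hτ a b γ hγ]
  group

variable [TopologicalSpace X]

/-- A function that is a potential near every point is a potential. -/
lemma isPotential_of_local (hi : Continuous i) {T : A → Γ}
    (h : ∀ x : X, ∃ V ∈ 𝓝 x, F.IsPotential i V T) : F.IsPotential i univ T := by
  intro a b α _
  -- `P` is an equivalence relation on the interval, and each `s` is related to all nearby `t`. The
  -- class of `0` is thus clopen, hence contains `1`.
  let P : I → I → Prop := fun s t => T (α s) * F.val (α.subpath s t) = T (α t)
  have hsymm : ∀ s t, P s t → P t s := by
    intro s t hst
    change T (α t) * F.val (α.subpath t s) = T (α s)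
    rw [← (show T (α s) * F.val (α.subpath s t) = T (α t) from hst), mul_assoc,
      F.val_subpath_mul, Path.subpath_self, F.val_refl, mul_one]
  have htrans : ∀ r s t, P r s → P s t → P r t := by
    intro r s t hrs hst
    change T (α r) * F.val (α.subpath r t) = T (α t)
    rw [← (show T (α s) * F.val (α.subpath s t) = T (α t) from hst),
      ← (show T (α r) * F.val (α.subpath r s) = T (α s) from hrs), mul_assoc,
      F.val_subpath_mul]
  have hloc : ∀ s, ∀ᶠ t in 𝓝 s, P s t := by
    intro s
    obtain ⟨V, hV, hT⟩ := h (i (α s))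
    have hpre : (fun t => i (α t)) ⁻¹' V ∈ 𝓝 s :=
      (hi.comp α.continuous).continuousAt.preimage_mem_nhds hV
    obtain ⟨ε, hε, hball⟩ := Metric.mem_nhds_iff.1 hpre
    filter_upwards [Metric.ball_mem_nhds s hε] with t ht
    refine hT _ _ _ fun u => ?_
    have hu := mem_range_self (f := α.subpath s t) u
    rw [Path.range_subpath] at hu
    obtain ⟨w, hw, hwu⟩ := hu
    rw [← hwu]
    refine hball ?_
    rw [Metric.mem_ball, Subtype.dist_eq, Real.dist_eq] at ht ⊢
    refine lt_of_le_of_lt ?_ ht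
    have hw' : (w : ℝ) ∈ uIcc (s : ℝ) t := by
      rcases le_total s t with hst | hst
      · rw [uIcc_of_le hst] at hw
        rw [uIcc_of_le (show (s : ℝ) ≤ t from hst)]
        exact hw
      · rw [uIcc_of_ge hst] at hw
        rw [uIcc_of_ge (show (t : ℝ) ≤ s from hst)]
        exact hw
    exact abs_sub_left_of_mem_uIcc hw'
  have hclopen : IsClopen {t | P 0 t} := by
    constructor
    · rw [← isOpen_compl_iff, isOpen_iff_mem_nhds]
      intro s hs
      filter_upwards [hloc s] with t ht h0
      exact hs (htrans _ _ _ h0 (hsymm _ _ ht))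
    · rw [isOpen_iff_mem_nhds]
      intro s hs
      filter_upwards [hloc s] with t ht
      exact htrans _ _ _ hs ht
  have h0 : P 0 0 := by
    change T (α 0) * F.val (α.subpath 0 0) = T (α 0)
    rw [Path.subpath_self, F.val_refl, mul_one]
  have h1 : (1 : I) ∈ {t | P 0 t} := by
    rw [hclopen.eq_univ ⟨0, h0⟩]
    trivial
  have h2 : T (α 0) * F.val (α.subpath 0 1) = T (α 1) := h1
  rw [Path.subpath_zero_one, F.val_cast] at h2
  simpa using h2

/-- The points of `X` with a neighbourhood whose preimage lies in the path component of `a` form a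
clopen set. It is closed because two overlapping neighbourhoods have a point of `A` over their
intersection, preimages of small open sets being nonempty. -/
theorem pathConnectedSpace_of_basis [PreconnectedSpace X] [Nonempty X]
    (hloc : ∀ x : X, ∀ W ∈ 𝓝 x, ∃ V ⊆ W, IsOpen V ∧ x ∈ V ∧ PreimagePathConnected i V) :
    PathConnectedSpace A := by
  obtain ⟨x₀⟩ := ‹Nonempty X›
  obtain ⟨-, -, -, -, ⟨a₀, -⟩, -⟩ := hloc x₀ univ univ_mem
  refine ⟨⟨a₀⟩, ?_⟩
  have key : ∀ a b : A, Joined a b := by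
    intro a
    let S : Set X := {x | ∃ V, IsOpen V ∧ x ∈ V ∧ PreimagePathConnected i V ∧
      ∀ b, i b ∈ V → Joined a b}
    have hS : IsClopen S := by
      constructor
      · rw [← isOpen_compl_iff, isOpen_iff_mem_nhds]
        intro x hx
        obtain ⟨V, -, hVo, hxV, hV⟩ := hloc x univ univ_mem
        filter_upwards [hVo.mem_nhds hxV] with y hyV
        rintro ⟨V', hV'o, hyV', hV', hj⟩
        obtain ⟨U, hU, -, -, ⟨c, hc⟩, -⟩ := hloc y (V ∩ V')
          (inter_mem (hVo.mem_nhds hyV) (hV'o.mem_nhds hyV'))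
        refine hx ⟨V, hVo, hxV, hV, fun b hb => (hj c (hU hc).2).trans ?_⟩
        exact ⟨(hV.2 c b (hU hc).1 hb).choose⟩
      · rw [isOpen_iff_mem_nhds]
        rintro x ⟨V, hVo, hxV, hV⟩
        filter_upwards [hVo.mem_nhds hxV] with y hy
        exact ⟨V, hVo, hy, hV⟩
    have hne : S.Nonempty := by
      obtain ⟨V, -, hVo, hxV, hV⟩ := hloc (i a) univ univ_mem
      exact ⟨i a, V, hVo, hxV, hV, fun b hb => ⟨(hV.2 a b hxV hb).choose⟩⟩
    intro b
    have hb : i b ∈ S := by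
      rw [hS.eq_univ hne]
      trivial
    obtain ⟨V, -, hb, -, hj⟩ := hb
    exact hj b hb
  exact key

/-- A path cocycle that is locally trivial over a simply connected space is trivial. -/
theorem val_eq_one_of_locally_trivial [SimplyConnectedSpace X] [LocallyPathConnectedSpace X]
    (hi : Continuous i)
    (hloc : ∀ x : X, ∀ W ∈ 𝓝 x, ∃ V ⊆ W, IsOpen V ∧ x ∈ V ∧ PreimagePathConnected i V ∧
      F.TrivialOver i V) {a : A} (γ : Path a a) : F.val γ = 1 := by
  classical
  choose V _ hVo hxV hVc hVt using fun x : X => hloc x univ univ_mem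
  choose τ hτ using fun x => (hVt x).exists_isPotential (hVc x)
  -- The image of `i` is dense, so a constant germ on `A` at `x` has a well defined value even when
  -- `x` is not in the image.
  have hne : ∀ x : X, (comap i (𝓝 x)).NeBot := by
    intro x
    rw [comap_neBot_iff]
    intro t ht
    obtain ⟨U, hU, -, -, ⟨⟨c, hc⟩, -⟩, -⟩ := hloc x t ht
    exact ⟨c, hU hc⟩
  have hex : ∀ j k x, x ∈ V j ∩ V k →
      ∃ g : Γ, ∀ᶠ y in comap i (𝓝 x), τ j y * (τ k y)⁻¹ = g := by
    intro j k x hx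
    obtain ⟨U, hU, hUo, hxU, hUc, -⟩ := hloc x (V j ∩ V k)
      (inter_mem ((hVo j).mem_nhds hx.1) ((hVo k).mem_nhds hx.2))
    obtain ⟨c, hc⟩ := hUc.1
    refine ⟨τ j c * (τ k c)⁻¹, ?_⟩
    filter_upwards [preimage_mem_comap (hUo.mem_nhds hxU)] with y hy
    exact IsPotential.div_eq hUc ((hτ j).mono fun z hz => (hU hz).1)
      ((hτ k).mono fun z hz => (hU hz).2) hy hc
  -- The transition function is the quotient of the potentials near `x`, extended over the points
  -- outside the image of `i`; the value 1 off the overlap is a dummy.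
  let g : X → X → X → Γ := fun j k x => if hx : x ∈ V j ∩ V k then (hex j k x hx).choose else 1
  have hg : ∀ j k x, x ∈ V j ∩ V k → ∀ᶠ y in comap i (𝓝 x), τ j y * (τ k y)⁻¹ = g j k x := by
    intro j k x hx
    simp only [g, dif_pos hx]
    exact (hex j k x hx).choose_spec
  have hguniq : ∀ j k x c, x ∈ V j ∩ V k →
      (∀ᶠ y in comap i (𝓝 x), τ j y * (τ k y)⁻¹ = c) → g j k x = c := by
    intro j k x c hx hc
    have := hne x
    obtain ⟨y, hy1, hy2⟩ := ((hg j k x hx).and hc).exists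
    exact hy1.symm.trans hy2
  have hgloc : ∀ j k x, x ∈ V j ∩ V k → ∀ᶠ x' in 𝓝 x, g j k x' = g j k x := by
    intro j k x hx
    have h1 := (hg j k x hx)
    rw [eventually_comap] at h1
    filter_upwards [h1.eventually_nhds, (hVo j).mem_nhds hx.1, (hVo k).mem_nhds hx.2]
      with x' hx' h2 h3
    exact hguniq j k x' _ ⟨h2, h3⟩ (eventually_comap.2 hx')
  -- With a discrete fibre, the bundle glued from the transition functions is a covering of `X`.
  let _ : TopologicalSpace Γ := ⊥
  have _ : DiscreteTopology Γ := ⟨rfl⟩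
  let Z : FiberBundleCore X X Γ :=
    { baseSet := V
      isOpen_baseSet := hVo
      indexAt := id
      mem_baseSet_at := hxV
      coordChange := fun j k x v => v * g j k x
      coordChange_self := fun j x hx v => by
        rw [hguniq j j x 1 ⟨hx, hx⟩ (Eventually.of_forall fun y => mul_inv_cancel _), mul_one]
      continuousOn_coordChange := by
        intro j k
        rintro ⟨x, v⟩ ⟨hx, -⟩
        refine ContinuousAt.continuousWithinAt ?_
        have h : ContinuousAt (fun q : X × Γ => q.2 * g j k x) (x, v) :=
          ((continuous_of_discreteTopology (f := fun w : Γ => w * g j k x)).comp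
            continuous_snd).continuousAt
        refine h.congr ?_
        have h2 : ∀ᶠ q : X × Γ in 𝓝 (x, v), g j k q.1 = g j k x :=
          (continuous_fst.tendsto (x, v)).eventually (hgloc j k x hx)
        filter_upwards [h2] with q hq
        rw [hq]
      coordChange_comp := by
        rintro j k l x ⟨⟨h1, h2⟩, h3⟩ v
        have := hne x
        obtain ⟨y, ⟨hy1, hy2⟩, hy3⟩ := (((hg j k x ⟨h1, h2⟩).and (hg k l x ⟨h2, h3⟩)).and
          (hg j l x ⟨h1, h3⟩)).exists
        rw [← hy1, ← hy2, ← hy3]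
        group }
  have hcov : IsCoveringMap Z.proj := FiberBundle.isCoveringMap
  -- Simple connectedness of `X` enters here: lifting the identity gives a global section.
  obtain ⟨s, ⟨-, hs⟩, -⟩ := hcov.existsUnique_continuousMap_lifts (ContinuousMap.id X) (i a)
    (⟨i a, (1 : Γ)⟩ : Z.TotalSpace) rfl
  have hs' : ∀ x, (s x).1 = x := fun x => congrFun hs x
  let c : X → X → Γ := fun j x => (Z.localTriv j (s x)).2
  have hcloc : ∀ j x, x ∈ V j → ∀ᶠ x' in 𝓝 x, c j x' = c j x := by
    intro j x hx
    have h1 : ContinuousAt (Z.localTriv j) (s x) :=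
      (Z.localTriv j).continuousAt (by
        rw [FiberBundleCore.mem_localTriv_source, ← FiberBundleCore.baseSet_at, hs' x]
        exact hx)
    have h2 : ContinuousAt (c j) x :=
      continuous_snd.continuousAt.comp (h1.comp s.continuous.continuousAt)
    have h3 := h2.preimage_mem_nhds (mem_nhds_discrete.2 (mem_singleton (c j x)))
    exact h3
  have hcc : ∀ j x, c j x = c x x * g x j x := by
    intro j x
    have h : ∀ q : Z.TotalSpace, q.1 = x → (Z.localTriv j q).2 =
        (Z.localTriv x q).2 * g x j x := by
      rintro ⟨y, v⟩ rfl
      have h1 : g y y y = 1 :=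
        hguniq y y y 1 ⟨hxV y, hxV y⟩ (Eventually.of_forall fun z => mul_inv_cancel _)
      simp only [FiberBundleCore.localTriv_apply]
      have h2 : ∀ w : Γ, w * g y j y = w * g y y y * g y j y := fun w => by rw [h1, mul_one]
      exact h2 v
    exact h _ (hs' x)
  -- The coordinates of the section satisfy `c k = c j * g j k` on overlaps, so `c j * τ j` does not
  -- depend on `j`. As each `c j` is locally constant, this product is locally a potential.
  let T : A → Γ := fun b => c (i b) (i b) * τ (i b) b
  have hT : ∀ j b, i b ∈ V j → T b = c j (i b) * τ j b := by
    intro j b hb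
    have h1 := (hg (i b) j (i b) ⟨hxV _, hb⟩)
    rw [eventually_comap] at h1
    rw [hcc j (i b), ← h1.self_of_nhds b rfl]
    simp only [T]
    group
  have hTpot : F.IsPotential i univ T := by
    refine isPotential_of_local hi fun x => ⟨{x' | c x x' = c x x} ∩ V x,
      inter_mem (hcloc x x (hxV x)) ((hVo x).mem_nhds (hxV x)), ?_⟩
    intro b b' α hα
    have hb := hα 0
    have hb' := hα 1
    rw [α.source] at hb
    rw [α.target] at hb'
    rw [hT x b hb.2, hT x b' hb'.2, hb.1, hb'.1, mul_assoc, hτ x b b' α fun t => (hα t).2]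
  have h := hTpot a a γ fun _ => mem_univ _
  exact mul_eq_left.1 h

end PathCocycle

end Cocycle

/-! ### Nooses built from an arc and a disk. -/

section NooseOfArc

/-- The segment meets the half-plane only at `1`. Hence the real part alone separates disk and arc
in the definition of `nooseMap`. -/
lemma NooseSpace.norm_le_one_of_re_le_one {z : NooseSpace} (hz : (z : ℂ).re ≤ 1) :
    ‖(z : ℂ)‖ ≤ 1 := by
  obtain ⟨z, hz' | ⟨a, b, ha, hb, hab, rfl⟩⟩ := z
  · simpa using hz'
  · simp only [Complex.real_smul, Complex.add_re, Complex.mul_re, Complex.ofReal_re,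
      Complex.one_re, Complex.ofReal_im, Complex.one_im, Complex.re_ofNat, Complex.im_ofNat] at hz
    have hb0 : b = 0 := by linarith
    have ha1 : a = 1 := by linarith
    simp [hb0, ha1]

lemma eq_one_of_norm_le_one_of_one_le_re {z : ℂ} (hz : ‖z‖ ≤ 1) (hz' : 1 ≤ z.re) : z = 1 := by
  have h1 : z.re ≤ ‖z‖ := Complex.re_le_norm z
  have h2 : z.re = 1 := by linarith
  have h3 : ‖z‖ = 1 := by linarith
  have h4 : z.re ^ 2 + z.im ^ 2 = 1 := by
    rw [← Complex.sq_norm_sub_sq_re z, h3]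
    ring
  have h5 : z.im = 0 := by
    rw [h2] at h4
    simpa using h4
  exact Complex.ext (by simpa using h2) (by simpa using h5)

lemma NooseSpace.diskPoint_re_le (r t : I) :
    ((NooseSpace.diskPoint r t : NooseSpace) : ℂ).re ≤ 1 := by
  refine (Complex.re_le_norm _).trans ?_
  have h : ‖Complex.exp (2 * Real.pi * Complex.I * (t : ℝ))‖ = 1 := by
    rw [← Complex.norm_exp_ofReal_mul_I (2 * Real.pi * t)]
    congr 2
    push_cast
    ring
  have h0 : |(r : ℝ)| = r := abs_of_nonneg r.2.1
  simpa [NooseSpace.diskPoint, h, h0] using r.2.2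

/-- The continuous map on the noose given by a map `D` on the disk and a path `α` that ends
at `D 1`. -/
def nooseMap {X : Type*} [TopologicalSpace X] {p c : X} (α : Path p c) (D : ℂ → X)
    (hD : ContinuousOn D (Metric.closedBall 0 1)) (hc : D 1 = c) : C(NooseSpace, X) where
  -- The radial retraction is the identity on the disk. It makes the first branch continuous on the
  -- whole noose, although `D` is only continuous on the disk.
  toFun z := if (z : ℂ).re ≤ 1 then D ((max 1 ‖(z : ℂ)‖ : ℝ)⁻¹ • (z : ℂ))
    else α.extend (2 - (z : ℂ).re)
  continuous_toFun := by
    have hre : Continuous fun z : NooseSpace => (z : ℂ).re :=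
      Complex.continuous_re.comp continuous_subtype_val
    refine Continuous.if_le ?_ ?_ hre continuous_const ?_
    · refine hD.comp_continuous ?_ fun z => ?_
      · refine Continuous.smul (Continuous.inv₀ (Continuous.max continuous_const
          continuous_subtype_val.norm) fun z => ?_) continuous_subtype_val
        have : (0 : ℝ) < max 1 ‖(z : ℂ)‖ := lt_max_of_lt_left one_pos
        exact this.ne'
      · have h0 : (0 : ℝ) < max 1 ‖(z : ℂ)‖ := lt_max_of_lt_left one_pos
        rw [mem_closedBall_zero_iff, norm_smul, norm_inv, Real.norm_of_nonneg h0.le,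
          inv_mul_le_iff₀ h0, mul_one]
        exact le_max_right _ _
    · exact α.continuous_extend.comp (continuous_const.sub hre)
    · intro z hz
      have h1 := NooseSpace.norm_le_one_of_re_le_one hz.le
      have h2 := eq_one_of_norm_le_one_of_one_le_re h1 hz.ge
      rw [h2]
      norm_num [hc]

section

variable {X : Type*} [TopologicalSpace X] {p c : X} (α : Path p c) (D : ℂ → X)
  (hD : ContinuousOn D (Metric.closedBall 0 1)) (hc : D 1 = c)

lemma nooseMap_of_re_le {z : NooseSpace} (hz : (z : ℂ).re ≤ 1) :
    nooseMap α D hD hc z = D z := by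
  have h1 := NooseSpace.norm_le_one_of_re_le_one hz
  simp [nooseMap, hz, h1]

lemma nooseMap_of_one_le_re {z : NooseSpace} (hz : 1 ≤ (z : ℂ).re) :
    nooseMap α D hD hc z = α.extend (2 - (z : ℂ).re) := by
  rcases hz.eq_or_lt with h | h
  · rw [nooseMap_of_re_le _ _ _ _ h.ge,
      eq_one_of_norm_le_one_of_one_le_re (NooseSpace.norm_le_one_of_re_le_one h.ge) h.le]
    norm_num [hc]
  · simp [nooseMap, h.not_ge]

lemma nooseMap_arcPoint (t : I) : nooseMap α D hD hc (NooseSpace.arcPoint t) = α t := by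
  have h : ((NooseSpace.arcPoint t : NooseSpace) : ℂ).re = 2 - t := by
    simp only [NooseSpace.arcPoint, Complex.ofReal_re]
  rw [nooseMap_of_one_le_re _ _ _ _ (by rw [h]; linarith [t.2.2]), h]
  simp

lemma nooseMap_diskPoint (r t : I) : nooseMap α D hD hc (NooseSpace.diskPoint r t) =
    D ((r : ℝ) * Complex.exp (2 * Real.pi * Complex.I * (t : ℝ))) :=
  nooseMap_of_re_le _ _ _ _ (NooseSpace.diskPoint_re_le r t)

lemma nooseMap_center : nooseMap α D hD hc NooseSpace.center = D 0 :=
  nooseMap_of_re_le _ _ _ _ (by simp [NooseSpace.center])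

end

variable {X : Type*} [TopologicalSpace X] {S : Set X} {p : X} {hp : p ∉ S} {c : (Sᶜ : Set X)}

/-- The noose with the given arc and disk. -/
def nooseOfArc (α : Path (⟨p, hp⟩ : (Sᶜ : Set X)) c) (D : ℂ → X)
    (hD : ContinuousOn D (Metric.closedBall 0 1)) (hc : D 1 = c)
    (hS : ∀ z, ‖z‖ ≤ 1 → (D z ∈ S ↔ z = 0)) : Noose S p :=
  ⟨nooseMap (α.map continuous_subtype_val) D hD hc, by
    constructor
    · rw [← NooseSpace.arcPoint_zero, nooseMap_arcPoint]
      simp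
    · intro z
      rcases le_total (z : ℂ).re 1 with h | h
      · rw [nooseMap_of_re_le _ _ _ _ h, hS _ (NooseSpace.norm_le_one_of_re_le_one h),
          Subtype.ext_iff]
        rfl
      · rw [nooseMap_of_one_le_re _ _ _ _ h]
        constructor
        · intro hz
          have h1 := (α.map continuous_subtype_val).extend_range
          have h2 := Set.mem_range_self (f := (α.map continuous_subtype_val).extend)
            (2 - (z : ℂ).re)
          rw [h1] at h2
          obtain ⟨t, ht⟩ := h2
          rw [← ht] at hz
          exact absurd hz (α t).2
        · rintro rfl
          norm_num [NooseSpace.center] at h⟩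

lemma augmentation_nooseOfArc (α : Path (⟨p, hp⟩ : (Sᶜ : Set X)) c) (D : ℂ → X)
    (hD : ContinuousOn D (Metric.closedBall 0 1)) (hc : D 1 = c)
    (hS : ∀ z, ‖z‖ ≤ 1 → (D z ∈ S ↔ z = 0)) (β : Path c c)
    (hβ : ∀ t : I, (β t : X) = D (Complex.exp (2 * Real.pi * Complex.I * (t : ℝ)))) :
    augmentation S p hp (FundamentalQuandle.mk (nooseOfArc α D hD hc hS)) =
      FundamentalGroup.fromPath (Path.Homotopic.Quotient.mk ((α.trans β).trans α.symm)) := by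
  change FundamentalGroup.fromPath (Path.Homotopic.Quotient.mk
    ((nooseOfArc α D hD hc hS).canonicalLoop hp)) = _
  congr 2
  have harc : ∀ t, (nooseOfArc α D hD hc hS).arc hp t = α t := fun t => Subtype.ext
    (nooseMap_arcPoint (α.map continuous_subtype_val) D hD hc t)
  have hcirc : ∀ t, (nooseOfArc α D hD hc hS).circle t = β t := fun t => Subtype.ext (by
    rw [hβ]
    refine (nooseMap_diskPoint (α.map continuous_subtype_val) D hD hc 1 t).trans ?_
    simp)
  ext t
  simp only [Noose.canonicalLoop, Path.trans_apply, Path.symm_apply, Function.comp_apply, harc, hcirc]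

end NooseOfArc

/-! ### Slice charts, logarithmic polar coordinates and meridians. -/

section Slice

open Set

namespace PathCocycle

variable {A B Γ : Type*} [TopologicalSpace A] [TopologicalSpace B] [Group Γ]

lemma val_congr (F : PathCocycle A Γ) {a b a' b' : A} (α : Path a b) (β : Path a' b')
    (h : ∀ t, α t = β t) : F.val α = F.val β := by
  have h0 : a = a' := by simpa using h 0
  have h1 : b = b' := by simpa using h 1
  subst h0 h1
  congr 1
  ext t
  exact h t

/-- The pull back of a path cocycle by a continuous map. -/
def comap (F : PathCocycle A Γ) (g : C(B, A)) : PathCocycle B Γ where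
  val α := F.val (α.map g.continuous)
  val_trans α β := by rw [Path.map_trans, F.val_trans]
  val_homotopic h := F.val_homotopic (h.map g)

end PathCocycle

/-- A chart `ψ` with inverse `Φ` of the open set `V ⊆ X` onto the convex set `B`, in which `S` is
the zero set of the linear map `π`, and `B` is the product of a convex subset of the kernel of
`π` and an open disk of radius `δ` in the image of the section `s` of `π`. -/
structure IsSliceChart {X E : Type*} [TopologicalSpace X] [NormedAddCommGroup E] [NormedSpace ℝ E]
    (S V : Set X) (B : Set E) (Φ : E → X) (ψ : X → E) (π : E →L[ℝ] ℂ) (s : ℂ →L[ℝ] E)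
    (δ : ℝ) : Prop where
  convex : Convex ℝ B
  continuousOn : ContinuousOn Φ B
  continuousOn_inv : ContinuousOn ψ V
  mapsTo : MapsTo Φ B V
  mapsTo_inv : MapsTo ψ V B
  left_inv : ∀ y ∈ B, ψ (Φ y) = y
  right_inv : ∀ x ∈ V, Φ (ψ x) = x
  section_apply : ∀ z, π (s z) = z
  norm_lt : ∀ y ∈ B, ‖π y‖ < δ
  add_mem : ∀ y ∈ B, ∀ z : ℂ, ‖z‖ < δ → y + s (z - π y) ∈ B
  mem_iff : ∀ y ∈ B, Φ y ∈ S ↔ π y = 0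

namespace IsSliceChart

variable {X E : Type*} [TopologicalSpace X] [NormedAddCommGroup E] [NormedSpace ℝ E]
    {S V : Set X} {B : Set E} {Φ : E → X} {ψ : X → E} {π : E →L[ℝ] ℂ} {s : ℂ →L[ℝ] E}
    {δ : ℝ}

/-- Logarithmic polar coordinates for the complement of `S` in a slice chart. -/
def polarDomain (B : Set E) (δ : ℝ) : Set (E × ℂ) := B ×ˢ {θ | θ.re < Real.log δ}

lemma pos (h : IsSliceChart S V B Φ ψ π s δ) {y : E} (hy : y ∈ B) : 0 < δ :=
  (norm_nonneg _).trans_lt (h.norm_lt y hy)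

lemma norm_exp_lt (hδ : 0 < δ) {θ : ℂ} (hθ : θ.re < Real.log δ) : ‖Complex.exp θ‖ < δ := by
  rw [Complex.norm_exp, ← Real.lt_log_iff_exp_lt hδ]
  exact hθ

lemma polar_mem (h : IsSliceChart S V B Φ ψ π s δ) {u : E × ℂ} (hu : u ∈ polarDomain B δ) :
    u.1 + s (Complex.exp u.2 - π u.1) ∈ B :=
  h.add_mem _ hu.1 _ (norm_exp_lt (h.pos hu.1) hu.2)

lemma convex_polarDomain (h : IsSliceChart S V B Φ ψ π s δ) : Convex ℝ (polarDomain B δ) :=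
  h.convex.prod (convex_halfSpace_re_lt _)

/-- The parametrization of the complement of `S` by logarithmic polar coordinates. -/
def polar (h : IsSliceChart S V B Φ ψ π s δ) : C(polarDomain B δ, (Sᶜ : Set X)) where
  -- The normal coordinate of `u.1.1` is discarded and replaced by the exponential. Keeping this
  -- redundant coordinate avoids splitting `E` as a product, and the domain remains convex.
  toFun u := ⟨Φ (u.1.1 + s (Complex.exp u.1.2 - π u.1.1)), fun hS => by
    rw [h.mem_iff _ (h.polar_mem u.2)] at hS
    simp [h.section_apply] at hS⟩
  continuous_toFun := by
    refine Continuous.subtype_mk (h.continuousOn.comp_continuous ?_ fun u => h.polar_mem u.2) _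
    fun_prop

lemma polar_mem_chart (h : IsSliceChart S V B Φ ψ π s δ) (u : polarDomain B δ) :
    (h.polar u : X) ∈ V :=
  h.mapsTo (h.polar_mem u.2)

lemma ne_zero (h : IsSliceChart S V B Φ ψ π s δ) {a : X} (ha : a ∈ V) (haS : a ∉ S) :
    π (ψ a) ≠ 0 := by
  rw [Ne, ← h.mem_iff _ (h.mapsTo_inv ha), h.right_inv a ha]
  exact haS

lemma lift_mem (h : IsSliceChart S V B Φ ψ π s δ) {a : X} (ha : a ∈ V) {θ : ℂ}
    (hθ : Complex.exp θ = π (ψ a)) : (ψ a, θ) ∈ polarDomain B δ := by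
  refine ⟨h.mapsTo_inv ha, ?_⟩
  have h1 := h.norm_lt _ (h.mapsTo_inv ha)
  rw [← hθ, Complex.norm_exp, ← Real.lt_log_iff_exp_lt (h.pos (h.mapsTo_inv ha))] at h1
  exact h1

lemma polar_lift (h : IsSliceChart S V B Φ ψ π s δ) {a : (Sᶜ : Set X)} (ha : (a : X) ∈ V) {θ : ℂ}
    (hθ : Complex.exp θ = π (ψ a)) : h.polar ⟨(ψ a, θ), h.lift_mem ha hθ⟩ = a := by
  refine Subtype.ext ?_
  simp [polar, hθ, h.right_inv _ ha]

/-- The complement of `S` in `V` is the image of a convex set under `polar`. Only endpoints are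
lifted, so the discontinuity of the logarithm is harmless. -/
lemma preimagePathConnected (h : IsSliceChart S V B Φ ψ π s δ) (hB : B.Nonempty) :
    PathCocycle.PreimagePathConnected (Subtype.val : (Sᶜ : Set X) → X) V := by
  obtain ⟨y, hy⟩ := hB
  constructor
  · have hu : (y, ((Real.log δ - 1 : ℝ) : ℂ)) ∈ polarDomain B δ := ⟨hy, by simp⟩
    exact ⟨h.polar ⟨_, hu⟩, h.polar_mem_chart _⟩
  · intro a b ha hb
    have hlog : ∀ c : (Sᶜ : Set X), (c : X) ∈ V →
        Complex.exp (Complex.log (π (ψ c))) = π (ψ c) :=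
      fun c hc => Complex.exp_log (h.ne_zero hc c.2)
    have hpc : PathConnectedSpace (polarDomain B δ) :=
      isPathConnected_iff_pathConnectedSpace.1
        (h.convex_polarDomain.isPathConnected ⟨_, h.lift_mem ha (hlog a ha)⟩)
    let γ := PathConnectedSpace.somePath (⟨_, h.lift_mem ha (hlog a ha)⟩ : polarDomain B δ)
      ⟨_, h.lift_mem hb (hlog b hb)⟩
    refine ⟨(γ.map h.polar.continuous).cast (h.polar_lift ha (hlog a ha)).symm
      (h.polar_lift hb (hlog b hb)).symm, fun t => ?_⟩
    exact h.polar_mem_chart (γ t)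

variable {Γ : Type*} [Group Γ]

/-- A cocycle that is trivial on one meridian is trivial over the slice chart. -/
lemma trivialOver (h : IsSliceChart S V B Φ ψ π s δ) (F : PathCocycle (Sᶜ : Set X) Γ)
    {u v : polarDomain B δ} (huv : v.1 = u.1 + (0, 2 * Real.pi * Complex.I)) (β : Path u v)
    (hβ : F.val (β.map h.polar.continuous) = 1) : F.TrivialOver Subtype.val V := by
  set G := F.comap h.polar with hG
  have hcontr : ContractibleSpace (polarDomain B δ) :=
    h.convex_polarDomain.contractibleSpace ⟨_, u.2⟩
  have hsc : SimplyConnectedSpace (polarDomain B δ) := inferInstance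
  have huniq : ∀ {a b : polarDomain B δ} (α α' : Path a b), G.val α = G.val α' :=
    fun α α' => G.val_homotopic (SimplyConnectedSpace.paths_homotopic α α')
  have hT : ∀ w : polarDomain B δ,
      w.1 + (0, 2 * Real.pi * Complex.I) ∈ polarDomain B δ := by
    intro w
    refine ⟨by simpa using w.2.1, ?_⟩
    have := w.2.2
    simpa using this
  -- Translation by `2πi` preserves `polar`. Any path from `a` to `T a` is homotopic to `γ`, then
  -- `β`, then the reverse of `T ∘ γ`; the outer values cancel, so its value is that of the
  -- meridian, up to conjugation.
  let T : C(polarDomain B δ, polarDomain B δ) :=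
    ⟨fun w => ⟨w.1 + (0, 2 * Real.pi * Complex.I), hT w⟩, by fun_prop⟩
  have hpolT : ∀ w, h.polar (T w) = h.polar w := by
    intro w
    refine Subtype.ext ?_
    simp [polar, T, Complex.exp_add]
  have h1 : ∀ {a b : polarDomain B δ} (_ : b = T a) (α : Path a b), G.val α = 1 := by
    rintro a _ rfl α
    have hv : v = T u := Subtype.ext huv
    subst hv
    let γ := PathConnectedSpace.somePath a u
    rw [huniq α ((γ.trans β).trans (γ.map T.continuous).symm), G.val_trans, G.val_trans,
      G.val_symm]
    have h2 : G.val (γ.map T.continuous) = G.val γ :=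
      F.val_congr _ _ fun t => hpolT (γ t)
    rw [h2, show G.val β = 1 from hβ, mul_one, mul_inv_cancel]
  have h2 : ∀ (n : ℕ) {a b : polarDomain B δ},
      b.1 = (a.1.1, a.1.2 + n * (2 * Real.pi * Complex.I)) → ∀ α : Path a b, G.val α = 1 := by
    intro n
    induction n with
    | zero =>
      intro a b hab α
      have : a = b := Subtype.ext (by simp [hab])
      subst this
      rw [huniq α (Path.refl a), G.val_refl]
    | succ n ih =>
      intro a b hab α
      rw [huniq α ((PathConnectedSpace.somePath a (T a)).trans
        (PathConnectedSpace.somePath (T a) b)), G.val_trans, h1 rfl, one_mul]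
      refine ih ?_ _
      rw [hab]
      ext
      · simp [T]
      · simp only [T, Nat.cast_add, Nat.cast_one, ContinuousMap.coe_mk, Prod.snd_add]
        ring
  have h3 : ∀ (n : ℤ) {a b : polarDomain B δ},
      b.1 = (a.1.1, a.1.2 + n * (2 * Real.pi * Complex.I)) → ∀ α : Path a b, G.val α = 1 := by
    intro n a b hab α
    obtain ⟨k, rfl | rfl⟩ := n.eq_nat_or_neg
    · exact h2 k (by simpa using hab) α
    · have h4 := h2 k (a := b) (b := a) (by simp [hab]) α.symm
      rwa [G.val_symm, inv_eq_one] at h4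
  intro a γ hγ
  have hψ : Continuous fun t => ψ (γ t) :=
    h.continuousOn_inv.comp_continuous (continuous_subtype_val.comp γ.continuous) hγ
  let q : C(I, {z : ℂ // z ≠ 0}) :=
    ⟨fun t => ⟨π (ψ (γ t)), h.ne_zero (hγ t) (γ t).2⟩,
      (π.continuous.comp hψ).subtype_mk _⟩
  -- A continuous logarithm of the normal coordinate lifts the loop to a path whose ends differ by a
  -- multiple of `2πi`.
  obtain ⟨θ, hθ, -⟩ := Complex.isCoveringMap_exp.exists_path_lifts q (Complex.log (q 0))
    (Subtype.ext (Complex.exp_log (q 0).2).symm)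
  have hθ' : ∀ t, Complex.exp (θ t) = π (ψ (γ t)) := fun t =>
    congrArg Subtype.val (congrFun hθ t)
  let α : Path (⟨_, h.lift_mem (hγ 0) (hθ' 0)⟩ : polarDomain B δ)
      ⟨_, h.lift_mem (hγ 1) (hθ' 1)⟩ :=
    { toFun := fun t => ⟨_, h.lift_mem (hγ t) (hθ' t)⟩
      continuous_toFun := (hψ.prodMk θ.continuous).subtype_mk _
      source' := rfl
      target' := rfl }
  have hloop : Complex.exp (θ 1) = Complex.exp (θ 0) := by
    rw [hθ', hθ']
    simp
  obtain ⟨n, hn⟩ := Complex.exp_eq_exp_iff_exists_int.1 hloop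
  rw [← F.val_congr (α.map h.polar.continuous) γ fun t => h.polar_lift (hγ t) (hθ' t)]
  refine h3 n ?_ α
  simp [hn]

/-- The complement of `S` in a slice chart has a meridian `β` that bounds a disk `D`
centered at any point of `S`, on which the equation of `S` is linear, and that detects whether
cocycles are trivial. -/
lemma exists_meridian (h : IsSliceChart S V B Φ ψ π s δ) {y : E} (hy : y ∈ B) (hπ : π y = 0) :
    ∃ (c : (Sᶜ : Set X)) (β : Path c c) (D : ℂ → X) (w : ℂ),
      ContinuousOn D (Metric.closedBall 0 1) ∧ D 1 = c ∧ D 0 = Φ y ∧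
      (∀ z, ‖z‖ ≤ 1 → (D z ∈ S ↔ z = 0)) ∧
      (∀ t : I, (β t : X) = D (Complex.exp (2 * Real.pi * Complex.I * (t : ℝ)))) ∧
      w ≠ 0 ∧ (∀ z, ‖z‖ ≤ 1 → D z ∈ V ∧ π (ψ (D z)) = z * w) ∧
      ∀ F : PathCocycle (Sᶜ : Set X) Γ, F.val β = 1 → F.TrivialOver Subtype.val V := by
  -- Any real number below `Real.log δ` would do; the meridian gets the radius `δ / e`.
  let θ : ℂ := ((Real.log δ - 1 : ℝ) : ℂ)
  have hθ : θ.re < Real.log δ := by simp [θ]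
  let w := Complex.exp θ
  have hw : ‖w‖ < δ := norm_exp_lt (h.pos hy) hθ
  let D : ℂ → X := fun z => Φ (y + s (z * w))
  have hmem : ∀ z : ℂ, ‖z‖ ≤ 1 → y + s (z * w) ∈ B := by
    intro z hz
    have := h.add_mem y hy (z * w) (by
      rw [norm_mul]
      exact (mul_le_of_le_one_left (norm_nonneg _) hz).trans_lt hw)
    simpa [hπ] using this
  have hDπ : ∀ z : ℂ, π (y + s (z * w)) = z * w := by
    intro z
    rw [map_add, h.section_apply, hπ, zero_add]
  have hpath : ∀ t : I, (y, θ + 2 * Real.pi * Complex.I * (t : ℝ)) ∈ polarDomain B δ := by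
    intro t
    refine ⟨hy, ?_⟩
    simpa using hθ
  let β : Path (⟨_, hpath 0⟩ : polarDomain B δ) ⟨_, hpath 1⟩ :=
    { toFun := fun t => ⟨_, hpath t⟩
      continuous_toFun := by fun_prop
      source' := rfl
      target' := rfl }
  have hval : ∀ t : I, (h.polar (β t) : X) =
      D (Complex.exp (2 * Real.pi * Complex.I * (t : ℝ))) := by
    intro t
    simp [polar, β, D, w, hπ, Complex.exp_add, mul_comm]
  have hend : h.polar ⟨_, hpath 0⟩ = h.polar ⟨_, hpath 1⟩ := by
    refine Subtype.ext ((hval 0).trans (Eq.trans ?_ (hval 1).symm))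
    simp [Complex.exp_two_pi_mul_I]
  refine ⟨h.polar ⟨_, hpath 0⟩, (β.map h.polar.continuous).cast rfl hend, D, w, ?_, ?_, ?_, ?_,
    hval, Complex.exp_ne_zero _, ?_, ?_⟩
  · refine h.continuousOn.comp (by fun_prop) fun z hz => hmem z (by simpa using hz)
  · refine Eq.trans ?_ (hval 0).symm
    simp
  · simp [D]
  · intro z hz
    rw [h.mem_iff _ (hmem z hz), hDπ]
    simp [w]
  · intro z hz
    refine ⟨h.mapsTo (hmem z hz), ?_⟩
    rw [h.left_inv _ (hmem z hz), hDπ]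
  · intro F hF
    refine h.trivialOver F ?_ β (by rwa [PathCocycle.val_cast] at hF)
    simp

end IsSliceChart

end Slice

/-! ### Linear algebra of orientations and cokernels. -/

section Orientation

open Module

/-- The constant is the sign of `o` relative to `b₀`. The determinant criterion also covers families
that are not bases, and dimension zero, where an orientation is just a sign. -/
lemma exists_isPositiveBasis_iff {V : Type*} [AddCommGroup V] [Module ℝ V] {n : ℕ}
    (b₀ : Basis (Fin n) ℝ V) (o : Orientation ℝ V (Fin n)) :
    ∃ c : ℝ, c ≠ 0 ∧ ∀ v : Fin n → V, IsPositiveBasis o v ↔ 0 < c * b₀.det v := by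
  have hbasis : ∀ v : Fin n → V, b₀.det v ≠ 0 → ∃ b : Basis (Fin n) ℝ V, ⇑b = v := by
    intro v hv
    obtain ⟨hli, hsp⟩ := (Basis.is_basis_iff_det b₀).2 (isUnit_iff_ne_zero.2 hv)
    exact ⟨Basis.mk hli hsp.ge, Basis.coe_mk _ _⟩
  have hpos : ∀ b : Basis (Fin n) ℝ V, b₀.orientation = b.orientation ↔ 0 < b₀.det b :=
    fun b => b₀.orientation_eq_iff_det_pos b
  rcases b₀.orientation_eq_or_eq_neg o with rfl | rfl
  · refine ⟨1, one_ne_zero, fun v => ⟨?_, fun hv => ?_⟩⟩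
    · rintro ⟨b, rfl, hb⟩
      rw [one_mul, ← hpos, hb]
    · rw [one_mul] at hv
      obtain ⟨b, rfl⟩ := hbasis v hv.ne'
      exact ⟨b, rfl, ((hpos b).2 hv).symm⟩
  · refine ⟨-1, by norm_num, fun v => ⟨?_, fun hv => ?_⟩⟩
    · rintro ⟨b, rfl, hb⟩
      have h1 : ¬ 0 < b₀.det b := by
        rw [← hpos, hb]
        exact Module.Ray.ne_neg_self _
      have h2 : b₀.det b ≠ 0 := (b₀.isUnit_det b).ne_zero
      have h3 := lt_of_le_of_ne (not_lt.1 h1) h2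
      linarith
    · have hv' : b₀.det v < 0 := by linarith
      obtain ⟨b, rfl⟩ := hbasis v hv'.ne
      refine ⟨b, rfl, ?_⟩
      rw [← Basis.orientation_ne_iff_eq_neg, Ne, eq_comm, hpos]
      exact hv'.not_gt

variable {V W : Type*} [AddCommGroup V] [Module ℝ V] [AddCommGroup W] [Module ℝ W] {m : ℕ}

/-- The determinant of a family made of a family in the kernel of `Q` and two vectors with
prescribed values under `Q`. -/
lemma det_append (D : V →ₗ[ℝ] W) (Q : W →ₗ[ℝ] ℂ)
    (hDQ : LinearMap.ker Q = LinearMap.range D) (b₀ : Basis (Fin m) ℝ V)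
    (B₀ : Basis (Fin (m + 2)) ℝ W) {w₁ w₂ : W} (hB₀ : ⇑B₀ = Fin.append (D ∘ b₀) ![w₁, w₂])
    (hw₁ : Q w₁ = 1) (hw₂ : Q w₂ = Complex.I) (b : Fin m → V) (v₁ v₂ : W) (ε : ℝ)
    (hv₁ : Q v₁ = 1) (hv₂ : Q v₂ = ε * Complex.I) :
    B₀.det (Fin.append (D ∘ b) ![v₁, v₂]) = ε * b₀.det b := by
  have hQD : ∀ x, Q (D x) = 0 := fun x => by
    rw [← LinearMap.mem_ker, hDQ]
    exact ⟨x, rfl⟩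
  have hin : ∀ x, D x = ∑ i, b₀.repr x i • B₀ (Fin.castAdd 2 i) := by
    intro x
    conv_lhs => rw [← b₀.sum_repr x, map_sum]
    exact Finset.sum_congr rfl fun i _ => by simp [hB₀]
  have hD : ∀ x, B₀.repr (D x) = ∑ i, b₀.repr x i • B₀.repr (B₀ (Fin.castAdd 2 i)) := by
    intro x
    conv_lhs => rw [hin x]
    simp only [map_sum, map_smul]
  have hDl : ∀ x i, B₀.repr (D x) (Fin.castAdd 2 i) = b₀.repr x i := by
    intro x i
    rw [hD]
    simp [Finsupp.finsetSum_apply, Finsupp.single_apply]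
  have hDr : ∀ x j, B₀.repr (D x) (Fin.natAdd m j) = 0 := by
    intro x j
    rw [hD]
    simp only [Basis.repr_self, Finsupp.finsetSum_apply, Finsupp.smul_apply, smul_eq_mul]
    refine Finset.sum_eq_zero fun i _ => ?_
    rw [Finsupp.single_eq_of_ne, mul_zero]
    intro h
    have := congrArg Fin.val h
    simp only [Fin.val_castAdd, Fin.val_natAdd] at this
    omega
  have hB1 : B₀ (Fin.natAdd m 0) = w₁ := by simp [hB₀]
  have hB2 : B₀ (Fin.natAdd m 1) = w₂ := by simp [hB₀]
  have hr : ∀ v : W, ∀ c : ℝ, ∀ d : ℝ, Q v = c + d * Complex.I →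
      ∀ j, B₀.repr v (Fin.natAdd m j) = ![c, d] j := by
    intro v c d hv j
    have h1 : v - (c • w₁ + d • w₂) ∈ LinearMap.range D := by
      rw [← hDQ, LinearMap.mem_ker]
      simp [hv, hw₁, hw₂]
    obtain ⟨x, hx⟩ := h1
    have h2 : v = D x + (c • B₀ (Fin.natAdd m 0) + d • B₀ (Fin.natAdd m 1)) := by
      rw [hx, hB1, hB2]
      abel
    rw [h2, map_add, Finsupp.add_apply, hDr, zero_add]
    fin_cases j <;> simp [Fin.ext_iff]
  -- The vectors `D (b i)` have no normal component, so the matrix is block upper triangular. The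
  -- components of `v₁` and `v₂` along the range of `D` are irrelevant.
  have hmat : (B₀.toMatrix (Fin.append (D ∘ b) ![v₁, v₂])).submatrix finSumFinEquiv
      finSumFinEquiv = Matrix.fromBlocks (b₀.toMatrix b)
        (Matrix.of fun (i : Fin m) (j : Fin 2) => B₀.repr (![v₁, v₂] j) (Fin.castAdd 2 i)) 0
        !![1, 0; 0, ε] := by
    ext i j
    rcases i with i | i <;> rcases j with j | j
    · simp [Basis.toMatrix_apply, hDl]
    · simp [Basis.toMatrix_apply]
    · simp [Basis.toMatrix_apply, hDr]
    · simp only [Matrix.submatrix_apply, Basis.toMatrix_apply, finSumFinEquiv_apply_right,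
        Fin.append_right, Matrix.fromBlocks_apply₂₂]
      fin_cases j
      · rw [hr _ 1 0 (by simp [hv₁])]
        fin_cases i <;> simp
      · rw [hr _ 0 ε (by simp [hv₂])]
        fin_cases i <;> simp
  rw [Basis.det_apply, Basis.det_apply, ← Matrix.det_submatrix_equiv_self finSumFinEquiv, hmat,
    Matrix.det_fromBlocks_zero₂₁, Matrix.det_fin_two]
  simp [mul_comm]

/-- An isomorphism of the cokernel of `D` with `ℂ` preserves orientations up to a sign. -/
lemma exists_sign_oriented (D : V →ₗ[ℝ] W) (Q : W →ₗ[ℝ] ℂ)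
    (hQ : Function.Surjective Q) (hDQ : LinearMap.ker Q = LinearMap.range D)
    [FiniteDimensional ℝ V] [FiniteDimensional ℝ W]
    (hV : finrank ℝ V = m) (hW : finrank ℝ W = m + 2)
    (oV : Orientation ℝ V (Fin m)) (oW : Orientation ℝ W (Fin (m + 2))) :
    ∃ ε : ℝ, (ε = 1 ∨ ε = -1) ∧ ∀ (b : Basis (Fin m) ℝ V) (v₁ v₂ : W), Q v₁ = 1 →
      Q v₂ = ε * Complex.I →
      (IsPositiveBasis oV b ↔ IsPositiveBasis oW (Fin.append (D ∘ b) ![v₁, v₂])) := by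
  have b₀ : Basis (Fin m) ℝ V := (finBasis ℝ V).reindex (finCongr hV)
  obtain ⟨w₁, hw₁⟩ := hQ 1
  obtain ⟨w₂, hw₂⟩ := hQ Complex.I
  have hQD : ∀ x, Q (D x) = 0 := fun x => by
    rw [← LinearMap.mem_ker, hDQ]
    exact ⟨x, rfl⟩
  have hspan : ⊤ ≤ Submodule.span ℝ (Set.range (Fin.append (D ∘ b₀) ![w₁, w₂])) := by
    intro w _
    have h1 : w - ((Q w).re • w₁ + (Q w).im • w₂) ∈ LinearMap.range D := by
      rw [← hDQ, LinearMap.mem_ker]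
      simp [hw₁, hw₂]
    obtain ⟨x, hx⟩ := h1
    have h2 : w = D x + ((Q w).re • w₁ + (Q w).im • w₂) := by
      rw [hx]
      abel
    rw [h2]
    refine add_mem ?_ (add_mem (Submodule.smul_mem _ _ (Submodule.subset_span
      ⟨Fin.natAdd m 0, by simp⟩)) (Submodule.smul_mem _ _ (Submodule.subset_span
      ⟨Fin.natAdd m 1, by simp⟩)))
    rw [← b₀.sum_repr x, map_sum]
    refine sum_mem fun i _ => ?_
    rw [map_smul]
    exact Submodule.smul_mem _ _ (Submodule.subset_span ⟨Fin.castAdd 2 i, by simp⟩)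
  have hli := linearIndependent_of_top_le_span_of_card_eq_finrank hspan (by simp [hW])
  obtain ⟨c, hc, hcV⟩ := exists_isPositiveBasis_iff b₀ oV
  obtain ⟨d, hd, hdW⟩ := exists_isPositiveBasis_iff (Basis.mk hli hspan) oW
  have hdet := det_append D Q hDQ b₀ (Basis.mk hli hspan) (Basis.coe_mk hli hspan) hw₁ hw₂
  -- The claim compares the signs of `c * b₀.det b` and `d * ε * b₀.det b`, so `ε` must be the sign
  -- of `c * d`.
  rcases lt_or_gt_of_ne (mul_ne_zero hc hd) with hcd | hcd
  · refine ⟨-1, Or.inr rfl, fun b v₁ v₂ h₁ h₂ => ?_⟩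
    rw [hcV, hdW, hdet b v₁ v₂ (-1) h₁ h₂]
    rcases mul_neg_iff.1 hcd with ⟨h, h'⟩ | ⟨h, h'⟩
    · rw [mul_pos_iff_of_pos_left h, neg_one_mul, mul_neg, neg_pos, mul_neg_iff]
      grind
    · rw [mul_pos_iff, neg_one_mul, mul_neg, neg_pos, mul_neg_iff]
      grind
  · refine ⟨1, Or.inl rfl, fun b v₁ v₂ h₁ h₂ => ?_⟩
    rw [hcV, hdW, hdet b v₁ v₂ 1 h₁ h₂, one_mul, mul_pos_iff, mul_pos_iff]
    rcases mul_pos_iff.1 hcd with ⟨h, h'⟩ | ⟨h, h'⟩ <;> grind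

end Orientation

/-! ### Convex charts and slice charts of manifolds with boundary. -/

section Charts

open Set Metric

variable {E H M : Type*} [NormedAddCommGroup E] [NormedSpace ℝ E] [TopologicalSpace H]
  {J : ModelWithCorners ℝ E H} [TopologicalSpace M]

/-- At a boundary point the target is a neighbourhood only within `range J`. Intersections of `range
J` with a ball are still convex, which suffices below. -/
lemma exists_ball_extend_target (e : OpenPartialHomeomorph M H) {x : M} (hx : x ∈ e.source)
    {W : Set M} (hW : W ∈ 𝓝 x) :
    ∃ ρ > 0, ∀ y ∈ range J, ‖y - e.extend J x‖ < ρ →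
      y ∈ (e.extend J).target ∧ (e.extend J).symm y ∈ W := by
  have h1 : (e.extend J).target ∈ 𝓝[range J] (e.extend J x) := e.extend_target_mem_nhdsWithin hx
  have h2 : (e.extend J).symm ⁻¹' W ∈ 𝓝[(e.extend J).symm ⁻¹' univ ∩ range J] (e.extend J x) :=
    e.extend_preimage_mem_nhdsWithin hx (mem_nhdsWithin_of_mem_nhds hW)
  rw [preimage_univ, univ_inter] at h2
  obtain ⟨ρ, hρ, hball⟩ := Metric.mem_nhdsWithin_iff.1 (Filter.inter_mem h1 h2)
  exact ⟨ρ, hρ, fun y hy hyρ => hball ⟨by rwa [mem_ball, dist_eq_norm], hy⟩⟩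

/-- Every point of a manifold with boundary has arbitrarily small neighbourhoods with charts onto
convex sets. -/
lemma exists_convex_chart (J : ModelWithCorners ℝ E H) (e : OpenPartialHomeomorph M H)
    {x : M} (hx : x ∈ e.source) {W : Set M} (hW : W ∈ 𝓝 x) :
    ∃ V ⊆ W, IsOpen V ∧ x ∈ V ∧ ∃ (B : Set E) (Φ : E → M) (ψ : M → E), Convex ℝ B ∧
      ContinuousOn Φ B ∧ ContinuousOn ψ V ∧ MapsTo Φ B V ∧ MapsTo ψ V B ∧
      ∀ x ∈ V, Φ (ψ x) = x := by
  obtain ⟨ρ, hρ, hball⟩ := exists_ball_extend_target (J := J) e hx hW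
  have hsymm : ∀ x' ∈ e.source, (e.extend J).symm (e.extend J x') = x' :=
    fun x' hx' => e.extend_left_inv hx'
  have hrange : ∀ x', e.extend J x' ∈ range J := fun x' => ⟨e x', rfl⟩
  have hcont : ContinuousOn (e.extend J) e.source := by
    have h : ContinuousOn (e.extend J) (e.extend J).source := e.continuousOn_extend
    rwa [e.extend_source] at h
  refine ⟨e.source ∩ e.extend J ⁻¹' ball (e.extend J x) ρ, ?_,
    e.isOpen_extend_preimage isOpen_ball, ⟨hx, mem_ball_self hρ⟩,
    range J ∩ ball (e.extend J x) ρ, (e.extend J).symm, e.extend J,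
    J.convex_range.inter (convex_ball _ _), ?_, ?_, ?_, ?_, fun x' hx' => hsymm x' hx'.1⟩
  · rintro x' ⟨hx', hx''⟩
    rw [mem_preimage, mem_ball, dist_eq_norm] at hx''
    rw [← hsymm x' hx']
    exact (hball _ (hrange x') hx'').2
  · have hc : ContinuousOn (e.extend J).symm (e.extend J).target := e.continuousOn_extend_symm
    refine hc.mono ?_
    rintro y ⟨hy, hy'⟩
    rw [mem_ball, dist_eq_norm] at hy'
    exact (hball y hy hy').1
  · exact hcont.mono inter_subset_left
  · rintro y ⟨hy, hy'⟩
    rw [mem_ball, dist_eq_norm] at hy'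
    have ht := (hball y hy hy').1
    refine ⟨?_, ?_⟩
    · have := (e.extend J).map_target ht
      rwa [e.extend_source] at this
    · rw [mem_preimage, (e.extend J).right_inv ht, mem_ball, dist_eq_norm]
      exact hy'
  · rintro x' ⟨-, hx'⟩
    exact ⟨hrange x', hx'⟩

/-- A chart in which `S` is the zero set of a linear map `π` and in which a section `s` of `π` is
tangent to the boundary restricts to arbitrarily small slice charts. -/
lemma exists_isSliceChart (e : OpenPartialHomeomorph M H) {x : M} (hx : x ∈ e.source) {S : Set M}
    {W : Set M} (hW : W ∈ 𝓝 x) (π : E →L[ℝ] ℂ) (s : ℂ →L[ℝ] E) (hs : ∀ z, π (s z) = z)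
    (hπ : π (e.extend J x) = 0) {ε : ℝ} (hε : 0 < ε)
    (hsJ : ∀ y ∈ range J, ‖y - e.extend J x‖ < ε → ∀ z : ℂ, ‖z‖ < ε →
      y + s (z - π y) ∈ range J)
    (hS : ∀ᶠ x' in 𝓝 x, x' ∈ S ↔ π (e.extend J x') = 0) :
    ∃ V ⊆ W, IsOpen V ∧ x ∈ V ∧ V ⊆ e.source ∧ ∃ (B : Set E) (δ : ℝ), e.extend J x ∈ B ∧
      IsSliceChart S V B (e.extend J).symm (e.extend J) π s δ := by
  obtain ⟨ρ, hρ, hball⟩ := exists_ball_extend_target (J := J) e hx (Filter.inter_mem hW hS)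
  set y₀ := e.extend J x with hy₀
  have hsymm : ∀ x' ∈ e.source, (e.extend J).symm (e.extend J x') = x' :=
    fun x' hx' => e.extend_left_inv hx'
  have hrange : ∀ x', e.extend J x' ∈ range J := fun x' => ⟨e x', rfl⟩
  have hcont : ContinuousOn (e.extend J) e.source := by
    have h : ContinuousOn (e.extend J) (e.extend J).source := e.continuousOn_extend
    rwa [e.extend_source] at h
  have hsymmcont : ContinuousOn (e.extend J).symm (e.extend J).target := e.continuousOn_extend_symm
  have hs1 : 0 < 1 + ‖s‖ := by positivity
  -- The two bounds `δ` that define `C` give `‖y - y₀‖ < δ + ‖s‖ * δ = min ρ ε`.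
  let δ := min ρ ε / (1 + ‖s‖)
  have hδ : 0 < δ := div_pos (lt_min hρ hε) hs1
  have hδε : δ ≤ ε := (div_le_self (lt_min hρ hε).le (by linarith [norm_nonneg s])).trans
    (min_le_right _ _)
  -- A product neighbourhood rather than a ball: the tangential condition is unaffected by a change
  -- of the normal coordinate, as `add_mem` requires.
  let C : Set E := {y | ‖y - s (π y) - y₀‖ < δ ∧ ‖π y‖ < δ}
  have hC : ∀ y ∈ C, ‖y - y₀‖ < min ρ ε := by
    rintro y ⟨h1, h2⟩
    calc ‖y - y₀‖ = ‖(y - s (π y) - y₀) + s (π y)‖ := by congr 1; abel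
      _ ≤ ‖y - s (π y) - y₀‖ + ‖s‖ * ‖π y‖ :=
        (norm_add_le _ _).trans (add_le_add le_rfl (s.le_opNorm _))
      _ < δ + ‖s‖ * δ := add_lt_add_of_lt_of_le h1 (by gcongr)
      _ = min ρ ε := by
        simp only [δ]
        field_simp
  have hCo : IsOpen C :=
    (isOpen_lt (by fun_prop : Continuous fun y : E => ‖y - s (π y) - y₀‖) continuous_const).inter
      (isOpen_lt (by fun_prop : Continuous fun y : E => ‖π y‖) continuous_const)
  have hCc : Convex ℝ C := by
    have h1 : Convex ℝ ((ContinuousLinearMap.id ℝ E - s.comp π) ⁻¹' ball y₀ δ) :=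
      (convex_ball y₀ δ).linear_preimage
        (ContinuousLinearMap.id ℝ E - s.comp π : E →L[ℝ] E).toLinearMap
    have h2 : Convex ℝ (π ⁻¹' ball 0 δ) := (convex_ball 0 δ).linear_preimage π.toLinearMap
    convert h1.inter h2 using 1
    ext y
    simp [C, dist_eq_norm]
  have hy₀C : y₀ ∈ C := by simp [C, hπ, hδ]
  have hball' : ∀ y ∈ range J ∩ C, y ∈ (e.extend J).target ∧
      (e.extend J).symm y ∈ W ∩ {x' | x' ∈ S ↔ π (e.extend J x') = 0} :=
    fun y hy => hball y hy.1 ((hC y hy.2).trans_le (min_le_left _ _))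
  refine ⟨e.source ∩ e.extend J ⁻¹' C, ?_, e.isOpen_extend_preimage hCo, ⟨hx, ?_⟩,
    inter_subset_left, range J ∩ C, δ, ⟨hrange x, ?_⟩, ?_⟩
  · rintro x' ⟨hx', hx''⟩
    rw [← hsymm x' hx']
    exact (hball' _ ⟨hrange x', hx''⟩).2.1
  · exact hy₀C
  · exact hy₀C
  · refine
      { convex := J.convex_range.inter hCc
        continuousOn := hsymmcont.mono fun y hy => (hball' y hy).1
        continuousOn_inv := hcont.mono inter_subset_left
        mapsTo := ?_
        mapsTo_inv := fun x' hx' => ⟨hrange x', hx'.2⟩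
        left_inv := fun y hy => (e.extend J).right_inv (hball' y hy).1
        right_inv := fun x' hx' => hsymm x' hx'.1
        section_apply := hs
        norm_lt := fun y hy => hy.2.2
        add_mem := ?_
        mem_iff := ?_ }
    · intro y hy
      refine ⟨?_, ?_⟩
      · have := (e.extend J).map_target (hball' y hy).1
        rwa [e.extend_source] at this
      · rw [mem_preimage, (e.extend J).right_inv (hball' y hy).1]
        exact hy.2
    · rintro y ⟨hy, hyC⟩ z hz
      have h1 : π (y + s (z - π y)) = z := by rw [map_add, hs]; abel
      refine ⟨hsJ y hy ((hC y hyC).trans_le (min_le_right _ _)) z (hz.trans_le hδε), ?_, ?_⟩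
      · rw [h1]
        convert hyC.1 using 2
        rw [map_sub]
        abel
      · rwa [h1]
    · intro y hy
      have := (hball' y hy).2.2
      rwa [mem_ofPred_eq, (e.extend J).right_inv (hball' y hy).1] at this

/-- Manifolds with boundary are locally path connected. -/
lemma locallyPathConnectedSpace_of_chartedSpace (J : ModelWithCorners ℝ E H)
    [ChartedSpace H M] : LocallyPathConnectedSpace M := by
  refine .of_bases (p := fun x (V : Set M) => V ∈ 𝓝 x ∧ IsPathConnected V) (s := fun _ => id)
    (fun x => ⟨fun W => ⟨fun hW => ?_, ?_⟩⟩) fun x V hV => hV.2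
  · obtain ⟨V, hVW, hVo, hxV, B, Φ, ψ, hB, hΦ, hψ, hΦV, hψB, hinv⟩ :=
      exists_convex_chart J (chartAt H x) (mem_chart_source H x) hW
    refine ⟨V, ⟨hVo.mem_nhds hxV, ?_⟩, hVW⟩
    have hV : V = Φ '' B := by
      refine Subset.antisymm (fun x' hx' => ⟨ψ x', hψB hx', hinv x' hx'⟩) ?_
      rintro _ ⟨y, hy, rfl⟩
      exact hΦV hy
    rw [hV]
    exact (hB.isPathConnected ⟨_, hψB hxV⟩).image' hΦ
  · rintro ⟨V, hV, hVW⟩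
    exact Filter.mem_of_superset hV.1 hVW

/-- Outside `S`, cocycles on the complement of `S` are locally trivial. -/
lemma exists_trivialOver_of_notMem [ChartedSpace H M] (J : ModelWithCorners ℝ E H) {S : Set M}
    (hS : IsClosed S) {x : M} (hx : x ∉ S) {W : Set M} (hW : W ∈ 𝓝 x)
    {Γ : Type*} [Group Γ] (F : PathCocycle (Sᶜ : Set M) Γ) :
    ∃ V ⊆ W, IsOpen V ∧ x ∈ V ∧
      PathCocycle.PreimagePathConnected (Subtype.val : (Sᶜ : Set M) → M) V ∧
      F.TrivialOver Subtype.val V := by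
  obtain ⟨V, hVW, hVo, hxV, B, Φ, ψ, hB, hΦ, hψ, hΦV, hψB, hinv⟩ :=
    exists_convex_chart J (chartAt H x) (mem_chart_source H x)
      (Filter.inter_mem hW (hS.isOpen_compl.mem_nhds hx))
  let g : C(B, (Sᶜ : Set M)) := ⟨fun y => ⟨Φ y, (hVW (hΦV y.2)).2⟩,
    (hΦ.comp_continuous continuous_subtype_val fun y => y.2).subtype_mk _⟩
  have hcontr : ContractibleSpace B := hB.contractibleSpace ⟨_, hψB hxV⟩
  have hsc : SimplyConnectedSpace B := inferInstance
  have hgψ : ∀ (a : (Sᶜ : Set M)) (ha : (a : M) ∈ V), g ⟨ψ a, hψB ha⟩ = a :=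
    fun a ha => Subtype.ext (hinv a ha)
  refine ⟨V, hVW.trans inter_subset_left, hVo, hxV, ⟨⟨⟨x, hx⟩, hxV⟩, fun a b ha hb => ?_⟩,
    fun a γ hγ => ?_⟩
  · let γ := PathConnectedSpace.somePath (⟨ψ a, hψB ha⟩ : B) ⟨ψ b, hψB hb⟩
    exact ⟨(γ.map g.continuous).cast (hgψ a ha).symm (hgψ b hb).symm, fun t => hΦV (γ t).2⟩
  · have ha : (a : M) ∈ V := by simpa using hγ 0
    let α : Path (⟨ψ a, hψB ha⟩ : B) ⟨ψ a, hψB ha⟩ :=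
      { toFun := fun t => ⟨ψ (γ t), hψB (hγ t)⟩
        continuous_toFun := (hψ.comp_continuous
          (continuous_subtype_val.comp γ.continuous) hγ).subtype_mk _
        source' := by simp
        target' := by simp }
    rw [← F.val_congr (α.map g.continuous) γ fun t => hgψ _ (hγ t)]
    have h := (F.comap g).val_homotopic (SimplyConnectedSpace.paths_homotopic α (Path.refl _))
    rw [PathCocycle.val_refl] at h
    exact h

end Charts

/-! ### Half-spaces and sections tangent to their boundary. -/

section LinearSlices

open Set

lemma IsBoundaryModel.exists_functional {E H : Type*} [NormedAddCommGroup E] [NormedSpace ℝ E]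
    [CompleteSpace E] [TopologicalSpace H] {J : ModelWithCorners ℝ E H} (hJ : IsBoundaryModel J) :
    ∃ a : E →L[ℝ] ℝ, range J = {x | 0 ≤ a x} ∧
      ∀ x, x ∈ interior (range J) ↔ a = 0 ∨ 0 < a x := by
  obtain ⟨a, ha⟩ := hJ
  refine ⟨a, ha, fun x => ?_⟩
  by_cases h0 : a = 0
  · simp [ha, h0]
  · have hsurj : Function.Surjective a :=
      LinearMap.surjective (f := a.toLinearMap) fun h => h0 (ContinuousLinearMap.coe_injective h)
    have h1 := a.interior_preimage hsurj (Ici 0)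
    rw [interior_Ici] at h1
    rw [ha, show {x | 0 ≤ a x} = a ⁻¹' Ici 0 from rfl, h1]
    simp [h0]

lemma exists_section {E : Type*} [NormedAddCommGroup E] [NormedSpace ℝ E] (π : E →L[ℝ] ℂ)
    (hπ : Function.Surjective π) : ∃ s : ℂ →L[ℝ] E, ∀ z, π (s z) = z := by
  obtain ⟨v, hv⟩ := hπ 1
  obtain ⟨w, hw⟩ := hπ Complex.I
  refine ⟨Complex.reCLM.smulRight v + Complex.imCLM.smulRight w, fun z => ?_⟩
  simp [hv, hw]

/-- Any section can be corrected by multiples of `v`, which `π` does not see, until `a` vanishes on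
it. Moving along the corrected section stays in the half-space. -/
lemma exists_section_tangent {E : Type*} [NormedAddCommGroup E] [NormedSpace ℝ E] (π : E →L[ℝ] ℂ)
    (hπ : Function.Surjective π) (a : E →L[ℝ] ℝ) {v : E} (hv : π v = 0) (hav : a v ≠ 0) :
    ∃ s : ℂ →L[ℝ] E, (∀ z, π (s z) = z) ∧ ∀ z, a (s z) = 0 := by
  obtain ⟨s, hs⟩ := exists_section π hπ
  refine ⟨s - ((a v)⁻¹ • a.comp s).smulRight v, fun z => ?_, fun z => ?_⟩
  · simp [hs, hv]
  · simp only [sub_apply, ContinuousLinearMap.smulRight_apply,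
      smul_apply, ContinuousLinearMap.comp_apply, map_sub, map_smul,
      smul_eq_mul]
    field_simp
    simp

/-- A nonzero functional that is nonnegative on a half-space is nonnegative only there. -/
lemma nonneg_of_nonneg {E : Type*} [AddCommGroup E] [Module ℝ E] {a L : E →ₗ[ℝ] ℝ}
    (h : ∀ v, 0 ≤ a v → 0 ≤ L v) (hL : L ≠ 0) {u : E} (hu : 0 ≤ L u) : 0 ≤ a u := by
  by_contra! hau
  obtain ⟨v, hv⟩ : ∃ v, L v < 0 := by
    by_contra! hc
    refine hL (LinearMap.ext fun v => le_antisymm ?_ (hc v))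
    have := hc (-v)
    simpa using this
  have hav : a v < 0 := by
    by_contra! hc
    exact absurd (h v hc) hv.not_ge
  -- This vector lies in the kernel of `a`, so `L` is nonnegative on it. Hence `L u` is at most `(a
  -- u / a v) * L v < 0`.
  have h1 := h (-(u - (a u / a v) • v)) (by
    simp [div_mul_cancel₀ _ hav.ne])
  have h2 : 0 < a u / a v := div_pos_of_neg_of_neg hau hav
  simp only [map_neg, map_sub, map_smul, smul_eq_mul] at h1
  nlinarith [mul_neg_of_pos_of_neg h2 hv]

end LinearSlices

/-! ### Charts of the maximal atlas: interior points and derivatives. -/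

section ChartDerivatives

open Set

variable {E H M : Type*} [NormedAddCommGroup E] [NormedSpace ℝ E] [TopologicalSpace H]
  {J : ModelWithCorners ℝ E H} [TopologicalSpace M] [ChartedSpace H M]
  {e : OpenPartialHomeomorph M H} {x : M}

lemma mdifferentiable_of_mem_maximalAtlas (he : e ∈ IsManifold.maximalAtlas J ∞ M) :
    e.MDifferentiable J J :=
  ⟨(contMDiffOn_of_mem_maximalAtlas he).mdifferentiableOn (by simp),
    (contMDiffOn_symm_of_mem_maximalAtlas he).mdifferentiableOn (by simp)⟩

/-- Interior points are defined by the preferred chart. Maps with surjective differential preserve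
them; apply this to `e` and to its inverse. -/
lemma isInteriorPoint_iff_extend [IsManifold J ∞ M] (he : e ∈ IsManifold.maximalAtlas J ∞ M)
    (hx : x ∈ e.source) : J.IsInteriorPoint x ↔ e.extend J x ∈ interior (range J) := by
  have hd := mdifferentiable_of_mem_maximalAtlas he
  have h1 : J.IsInteriorPoint (e x) ↔ e.extend J x ∈ interior (range J) := by
    change extChartAt J (e x) (e x) ∈ interior (range J) ↔ J (e x) ∈ interior (range J)
    rw [extChartAt_coe, Function.comp_apply, chartAt_self_eq]
    rfl
  rw [← h1]
  constructor
  · exact (hd.mdifferentiableAt hx).isInteriorPoint_of_surjective_mfderiv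
      (hd.mfderiv_surjective hx)
  · intro h
    have h2 := (hd.symm.mdifferentiableAt (e.map_source hx)).isInteriorPoint_of_surjective_mfderiv
      (hd.symm.mfderiv_surjective (e.map_source hx)) h
    rwa [e.left_inv hx] at h2

lemma mfderiv_extend_bijective (he : e ∈ IsManifold.maximalAtlas J ∞ M) (hx : x ∈ e.source) :
    Function.Bijective (mfderiv J 𝓘(ℝ, E) (e.extend J) x) := by
  have hd := mdifferentiable_of_mem_maximalAtlas he
  have h : HasMFDerivAt J 𝓘(ℝ, E) (e.extend J) x (mfderiv J J e x) :=
    J.hasMFDerivAt.comp x (hd.mdifferentiableAt hx).hasMFDerivAt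
  rw [h.mfderiv]
  exact hd.mfderiv_bijective hx

lemma mdifferentiableAt_extend (he : e ∈ IsManifold.maximalAtlas J ∞ M) (hx : x ∈ e.source) :
    MDifferentiableAt J 𝓘(ℝ, E) (e.extend J) x :=
  (e.contMDiffAt_extend he hx).mdifferentiableAt (by simp)

end ChartDerivatives

/-! ### Local form of a properly embedded submanifold. -/

section Submanifold

open Set Module

variable {m : ℕ} {H H' : Type*} [TopologicalSpace H] [TopologicalSpace H']
  {J : ModelWithCorners ℝ (EuclideanSpace ℝ (Fin (m + 2))) H}
  {J' : ModelWithCorners ℝ (EuclideanSpace ℝ (Fin m)) H'}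
  {M : Type*} [TopologicalSpace M] [ChartedSpace H M]
  {K : Type*} [TopologicalSpace K] [ChartedSpace H' K]
  {f : K → M} {k : K}

/-- In slice charts, the inclusion of a properly embedded submanifold is `u ↦ (u, 0)`. -/
lemma extend_immersion (h : Manifold.IsImmersionAt J' J ∞ f k) {k' : K}
    (hk' : k' ∈ h.domChart.source) :
    h.codChart.extend J (f k') = h.equiv (h.domChart.extend J' k', 0) := by
  have h1 := h.writtenInCharts ((h.domChart.extend J').map_source
    (by rwa [h.domChart.extend_source] : k' ∈ (h.domChart.extend J').source))
  simp only [Function.comp_apply, h.domChart.extend_left_inv hk'] at h1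
  exact h1

variable [IsManifold J ∞ M] [IsManifold J' ∞ K]

/-- A properly embedded submanifold is transverse to the boundary. -/
lemma interior_or_transverse (hJ : IsBoundaryModel J) (hJ' : IsBoundaryModel J')
    (hf : IsProperlyEmbedded J J' f) (h : Manifold.IsImmersionAt J' J ∞ f k) :
    (h.codChart.extend J (f k) ∈ interior (range J) ∧
      h.domChart.extend J' k ∈ interior (range J')) ∨
    ∃ (a : EuclideanSpace ℝ (Fin (m + 2)) →L[ℝ] ℝ) (a' : EuclideanSpace ℝ (Fin m) →L[ℝ] ℝ),
      range J = {x | 0 ≤ a x} ∧ range J' = {x | 0 ≤ a' x} ∧ (∃ v, a (h.equiv (v, 0)) ≠ 0) ∧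
      ∀ u, 0 ≤ a (h.equiv (u, 0)) → 0 ≤ a' u := by
  obtain ⟨a, ha, hai⟩ := hJ.exists_functional
  obtain ⟨a', ha', hai'⟩ := hJ'.exists_functional
  have hint : ∀ k' ∈ h.domChart.source, (h.codChart.extend J (f k') ∈ interior (range J) ↔
      h.domChart.extend J' k' ∈ interior (range J')) := by
    intro k' hk'
    rw [← isInteriorPoint_iff_extend h.domChart_mem_maximalAtlas hk',
      ← isInteriorPoint_iff_extend h.codChart_mem_maximalAtlas (h.source_subset_preimage_source hk'),
      ModelWithCorners.isInteriorPoint_iff_not_isBoundaryPoint,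
      ModelWithCorners.isInteriorPoint_iff_not_isBoundaryPoint, not_iff_not]
    exact hf.boundary_iff k'
  have hk := h.mem_domChart_source
  by_cases hy : h.codChart.extend J (f k) ∈ interior (range J)
  · exact Or.inl ⟨hy, (hint k hk).1 hy⟩
  right
  have hu : h.domChart.extend J' k ∉ interior (range J') := fun hu => hy ((hint k hk).2 hu)
  have hy' : 0 ≤ a (h.codChart.extend J (f k)) := by
    have : h.codChart.extend J (f k) ∈ range J := ⟨_, rfl⟩
    rwa [ha] at this
  have hu' : 0 ≤ a' (h.domChart.extend J' k) := by
    have : h.domChart.extend J' k ∈ range J' := ⟨_, rfl⟩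
    rwa [ha'] at this
  rw [hai, not_or, not_lt] at hy
  rw [hai', not_or, not_lt] at hu
  have hy0 : a (h.codChart.extend J (f k)) = 0 := le_antisymm hy.2 hy'
  have hu0 : a' (h.domChart.extend J' k) = 0 := le_antisymm hu.2 hu'
  obtain ⟨ρ, hρ, hball⟩ := exists_ball_extend_target (J := J') h.domChart hk Filter.univ_mem
  have hchart : ∀ u ∈ range J', ‖u - h.domChart.extend J' k‖ < ρ →
      ∃ k' ∈ h.domChart.source, h.domChart.extend J' k' = u ∧
        h.codChart.extend J (f k') = h.equiv (u, 0) := by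
    intro u hur hun
    have ht := (hball u hur hun).1
    have hs := (h.domChart.extend J').map_target ht
    rw [h.domChart.extend_source] at hs
    refine ⟨_, hs, (h.domChart.extend J').right_inv ht, ?_⟩
    rw [extend_immersion h hs, (h.domChart.extend J').right_inv ht]
  -- The functional of `∂M` restricted to the slice. Transversality means that it is nonzero.
  let L : EuclideanSpace ℝ (Fin m) →ₗ[ℝ] ℝ :=
    a.toLinearMap ∘ₗ h.equiv.toLinearEquiv.toLinearMap ∘ₗ LinearMap.inl ℝ _ _
  have hL : ∀ u, L u = a (h.equiv (u, 0)) := fun u => rfl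
  have hL0 : L (h.domChart.extend J' k) = 0 := by
    rw [hL, ← extend_immersion h hk, hy0]
  -- If `L` vanished, interior points of `K` near `k` would be mapped into `∂M`, contrary to
  -- `boundary_iff`.
  have hLne : L ≠ 0 := by
    intro hz
    have hcl := J'.range_subset_closure_interior
      (⟨_, rfl⟩ : h.domChart.extend J' k ∈ range J')
    obtain ⟨u, hui, hud⟩ := Metric.mem_closure_iff.1 hcl ρ hρ
    rw [dist_comm, dist_eq_norm] at hud
    obtain ⟨k', hk's, hk'u, hk'e⟩ := hchart u (interior_subset hui) hud
    have h1 : h.codChart.extend J (f k') ∈ interior (range J) := by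
      rw [hint k' hk's, hk'u]
      exact hui
    rw [hai, hk'e, ← hL, hz] at h1
    rcases h1 with h1 | h1
    · exact hy.1 h1
    · simp at h1
  have hLpos : ∀ v, 0 ≤ a' v → 0 ≤ L v := by
    intro v hv
    -- A positive scale that brings `t • v` into the ball of radius `ρ`, also for `v = 0`.
    let t : ℝ := ρ / (2 * (‖v‖ + 1))
    have ht : 0 < t := by positivity
    have htv : ‖t • v‖ < ρ := by
      rw [norm_smul, Real.norm_of_nonneg ht.le]
      calc t * ‖v‖ ≤ t * (‖v‖ + 1) := by gcongr; linarith
        _ = ρ / 2 := by simp only [t]; field_simp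
        _ < ρ := half_lt_self hρ
    obtain ⟨k', -, -, hk'e⟩ := hchart (h.domChart.extend J' k + t • v)
      (by
        rw [ha', mem_ofPred_eq, map_add, hu0, map_smul, zero_add, smul_eq_mul]
        positivity) (by simpa using htv)
    have h1 : h.codChart.extend J (f k') ∈ range J := ⟨_, rfl⟩
    rw [ha, mem_ofPred_eq, hk'e, ← hL, map_add, hL0, map_smul, zero_add, smul_eq_mul] at h1
    exact nonneg_of_mul_nonneg_right h1 ht
  refine ⟨a, a', ha, ha', ?_, fun u hu =>
    nonneg_of_nonneg (a := a'.toLinearMap) hLpos hLne hu⟩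
  by_contra! hc
  exact hLne (LinearMap.ext fun v => hc v)

/-- In slice charts, a properly embedded submanifold is the slice where the second
coordinate vanishes. -/
lemma eventually_mem_range_iff (hJ : IsBoundaryModel J) (hJ' : IsBoundaryModel J')
    (hf : IsProperlyEmbedded J J' f) (h : Manifold.IsImmersionAt J' J ∞ f k) :
    ∀ᶠ x in 𝓝 (f k), x ∈ range f ↔ (h.equiv.symm (h.codChart.extend J x)).2 = 0 := by
  have hk := h.mem_domChart_source
  obtain ⟨ρ, hρ, hball⟩ := exists_ball_extend_target (J := J') h.domChart hk Filter.univ_mem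
  have hcont : ContinuousAt (fun x => (h.equiv.symm (h.codChart.extend J x)).1) (f k) :=
    continuous_fst.continuousAt.comp (h.equiv.symm.continuous.continuousAt.comp
      (h.codChart.continuousAt_extend h.mem_codChart_source))
  have hval : (h.equiv.symm (h.codChart.extend J (f k))).1 = h.domChart.extend J' k := by
    rw [extend_immersion h hk]
    simp
  have hnear : ∀ᶠ x in 𝓝 (f k),
      (h.equiv.symm (h.codChart.extend J x)).1 ∈ Metric.ball (h.domChart.extend J' k) ρ :=
    hcont.eventually (by beta_reduce; rw [hval]; exact Metric.ball_mem_nhds _ hρ)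
  -- A point of the slice inside `M` must have its tangential coordinate in the model of `K`. At the
  -- boundary this is the comparison of half-spaces; in the interior it holds by continuity.
  have hrange : ∀ᶠ x in 𝓝 (f k), (h.equiv.symm (h.codChart.extend J x)).2 = 0 →
      (h.equiv.symm (h.codChart.extend J x)).1 ∈ range J' := by
    rcases interior_or_transverse hJ hJ' hf h with ⟨-, hi⟩ | ⟨a, a', ha, ha', -, hpos⟩
    · have h1 := hcont.eventually (p := fun u => u ∈ range J')
        (by beta_reduce; rw [hval]; exact mem_interior_iff_mem_nhds.1 hi)
      exact h1.mono fun x hx _ => hx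
    · refine Filter.Eventually.of_forall fun x hx => ?_
      rw [ha']
      refine hpos _ ?_
      have h1 : h.codChart.extend J x ∈ range J := ⟨_, rfl⟩
      rw [ha] at h1
      have h2 : h.equiv ((h.equiv.symm (h.codChart.extend J x)).1, 0) =
          h.codChart.extend J x := by
        rw [← hx, Prod.mk.eta, h.equiv.apply_symm_apply]
      rw [h2]
      exact h1
  -- As `f` is an embedding, no other sheet of `K` comes near `f k`.
  obtain ⟨O, hO, hOs⟩ := hf.isSmoothEmbedding.isEmbedding.isInducing.isOpen_iff.1
    h.domChart.open_source
  have hkO : f k ∈ O := by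
    have := hk
    rwa [← hOs] at this
  filter_upwards [hnear, hrange, hO.mem_nhds hkO,
    h.codChart.open_source.mem_nhds h.mem_codChart_source] with x hx1 hx2 hxO hxs
  constructor
  · rintro ⟨k', rfl⟩
    have hk' : k' ∈ h.domChart.source := by
      rw [← hOs]
      exact hxO
    rw [extend_immersion h hk']
    simp
  · intro hx0
    rw [mem_ball_iff_norm] at hx1
    have ht := (hball _ (hx2 hx0) hx1).1
    have hs := (h.domChart.extend J').map_target ht
    rw [h.domChart.extend_source] at hs
    refine ⟨(h.domChart.extend J').symm (h.equiv.symm (h.codChart.extend J x)).1, ?_⟩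
    have h1 := extend_immersion h hs
    rw [(h.domChart.extend J').right_inv ht, ← hx0, Prod.mk.eta, h.equiv.apply_symm_apply] at h1
    have h2 := congrArg (h.codChart.extend J).symm h1
    rwa [h.codChart.extend_left_inv hxs,
      h.codChart.extend_left_inv (h.source_subset_preimage_source hs)] at h2

/-- An equation of a slice has a section that is tangent to the boundary. -/
lemma exists_section_of_slice (hJ : IsBoundaryModel J) (hJ' : IsBoundaryModel J')
    (hf : IsProperlyEmbedded J J' f) (h : Manifold.IsImmersionAt J' J ∞ f k)
    (π : EuclideanSpace ℝ (Fin (m + 2)) →L[ℝ] ℂ) (hπ : Function.Surjective π)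
    (hπ0 : ∀ u, π (h.equiv (u, 0)) = 0) :
    ∃ s : ℂ →L[ℝ] EuclideanSpace ℝ (Fin (m + 2)), (∀ z, π (s z) = z) ∧ ∃ ε > 0,
      ∀ y ∈ range J, ‖y - h.codChart.extend J (f k)‖ < ε → ∀ z : ℂ, ‖z‖ < ε →
        y + s (z - π y) ∈ range J := by
  -- In the interior any section works for small displacements. At the boundary the section is made
  -- tangent to it, and no smallness is needed.
  rcases interior_or_transverse hJ hJ' hf h with ⟨hi, -⟩ | ⟨a, a', ha, -, ⟨v, hv⟩, -⟩
  · obtain ⟨s, hs⟩ := exists_section π hπ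
    refine ⟨s, hs, ?_⟩
    have hcont : Continuous fun q : EuclideanSpace ℝ (Fin (m + 2)) × ℂ =>
        q.1 + s (q.2 - π q.1) := by fun_prop
    have hy0 : π (h.codChart.extend J (f k)) = 0 := by
      rw [extend_immersion h h.mem_domChart_source, hπ0]
    have hev := (hcont.tendsto (h.codChart.extend J (f k), (0 : ℂ))).eventually
      (p := fun y => y ∈ range J) (by
        simp only [hy0, sub_zero, map_zero, add_zero]
        exact mem_interior_iff_mem_nhds.1 hi)
    obtain ⟨ε, hε, hball⟩ := Metric.eventually_nhds_iff.1 hev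
    refine ⟨ε, hε, fun y _ hy z hz => hball (y := (y, z)) ?_⟩
    rw [Prod.dist_eq, max_lt_iff, dist_eq_norm, dist_eq_norm, sub_zero]
    exact ⟨hy, hz⟩
  · obtain ⟨s, hs, has⟩ := exists_section_tangent π hπ a (hπ0 v) hv
    refine ⟨s, hs, 1, one_pos, fun y hy _ z _ => ?_⟩
    rw [ha, mem_ofPred_eq] at hy ⊢
    rwa [map_add, has, add_zero]

end Submanifold

/-! ### Oriented linear equations and meridians of linking number 1. -/

section OrientedEquation

open Set Module

lemma finrank_complement {m : ℕ} {F : Type*} [NormedAddCommGroup F] [NormedSpace ℝ F]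
    (L : (EuclideanSpace ℝ (Fin m) × F) ≃L[ℝ] EuclideanSpace ℝ (Fin (m + 2))) :
    FiniteDimensional ℝ F ∧ finrank ℝ F = 2 := by
  have h1 : FiniteDimensional ℝ (EuclideanSpace ℝ (Fin m) × F) :=
    L.toLinearEquiv.symm.finiteDimensional
  have h2 : FiniteDimensional ℝ F :=
    FiniteDimensional.of_injective (LinearMap.inr ℝ (EuclideanSpace ℝ (Fin m)) F)
      LinearMap.inr_injective
  refine ⟨h2, ?_⟩
  have h3 := L.toLinearEquiv.finrank_eq
  rw [Module.finrank_prod, finrank_euclideanSpace_fin, finrank_euclideanSpace_fin] at h3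
  omega

variable {m : ℕ} {H H' : Type*} [TopologicalSpace H] [TopologicalSpace H']
  {J : ModelWithCorners ℝ (EuclideanSpace ℝ (Fin (m + 2))) H}
  {J' : ModelWithCorners ℝ (EuclideanSpace ℝ (Fin m)) H'}
  {M : Type*} [TopologicalSpace M] [ChartedSpace H M]
  {K : Type*} [TopologicalSpace K] [ChartedSpace H' K]
  {f : K → M} {k : K}

/-- Differentiate `extend_immersion` at `k`. -/
lemma mfderiv_extend_immersion (h : Manifold.IsImmersionAt J' J ∞ f k) (v : TangentSpace J' k) :
    mfderiv J 𝓘(ℝ, EuclideanSpace ℝ (Fin (m + 2))) (h.codChart.extend J) (f k)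
      (mfderiv J' J f k v) =
    h.equiv (mfderiv J' 𝓘(ℝ, EuclideanSpace ℝ (Fin m)) (h.domChart.extend J') k v, 0) := by
  have hk := h.mem_domChart_source
  have hA := (mdifferentiableAt_extend h.codChart_mem_maximalAtlas
    h.mem_codChart_source).hasMFDerivAt
  have hA' := (mdifferentiableAt_extend h.domChart_mem_maximalAtlas hk).hasMFDerivAt
  have hD := (h.contMDiffAt.mdifferentiableAt (by simp)).hasMFDerivAt
  have h1 := hA.comp k hD
  let L : EuclideanSpace ℝ (Fin m) →L[ℝ] EuclideanSpace ℝ (Fin (m + 2)) :=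
    h.equiv.toContinuousLinearMap.comp (ContinuousLinearMap.inl ℝ _ _)
  have h2 := (L.hasMFDerivAt (x := h.domChart.extend J' k)).comp k hA'
  have h3 : h.codChart.extend J ∘ f =ᶠ[𝓝 k] L ∘ h.domChart.extend J' := by
    filter_upwards [h.domChart.open_source.mem_nhds hk] with k' hk'
    exact extend_immersion h hk'
  have h4 := hasMFDerivAt_unique h1 (h2.congr_of_eventuallyEq h3)
  exact congrArg (fun T => T v) h4

variable [IsManifold J ∞ M] [IsManifold J' ∞ K]

/-- A properly embedded oriented submanifold of codimension 2 has an oriented equation that is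
linear in a slice chart. -/
lemma exists_linear_orientedEquation (oM : ManifoldOrientation J M) (oK : ManifoldOrientation J' K)
    (h : Manifold.IsImmersionAt J' J ∞ f k) :
    ∃ π : EuclideanSpace ℝ (Fin (m + 2)) →L[ℝ] ℂ, Function.Surjective π ∧
      (∀ y, π y = 0 ↔ (h.equiv.symm y).2 = 0) ∧
      ∀ V : Set M, IsOpen V → f k ∈ V → V ⊆ h.codChart.source →
        (∀ x ∈ V, π (h.codChart.extend J x) = 0 ↔ x ∈ range f) →
        IsOrientedEquation oM oK f k V (fun x => π (h.codChart.extend J x)) := by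
  obtain ⟨hfd, hrank⟩ := finrank_complement h.equiv
  let c : h.complement ≃L[ℝ] ℂ := ContinuousLinearEquiv.ofFinrankEq (by
    rw [hrank, Complex.finrank_real_complex])
  let π₁ : EuclideanSpace ℝ (Fin (m + 2)) →L[ℝ] ℂ :=
    c.toContinuousLinearMap.comp ((ContinuousLinearMap.snd ℝ _ _).comp
      h.equiv.symm.toContinuousLinearMap)
  have hπ₁ : ∀ y, π₁ y = c (h.equiv.symm y).2 := fun y => rfl
  have hπ₁0 : ∀ y, π₁ y = 0 ↔ (h.equiv.symm y).2 = 0 := fun y => by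
    rw [hπ₁, c.map_eq_zero_iff]
  have hπ₁s : Function.Surjective π₁ := by
    intro z
    refine ⟨h.equiv (0, c.symm z), ?_⟩
    simp [hπ₁]
  let A : TangentSpace J (f k) →L[ℝ] EuclideanSpace ℝ (Fin (m + 2)) :=
    mfderiv J 𝓘(ℝ, EuclideanSpace ℝ (Fin (m + 2))) (h.codChart.extend J) (f k)
  have hA : Function.Bijective A :=
    mfderiv_extend_bijective h.codChart_mem_maximalAtlas h.mem_codChart_source
  let A' : TangentSpace J' k →L[ℝ] EuclideanSpace ℝ (Fin m) :=
    mfderiv J' 𝓘(ℝ, EuclideanSpace ℝ (Fin m)) (h.domChart.extend J') k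
  have hA' : Function.Bijective A' :=
    mfderiv_extend_bijective h.domChart_mem_maximalAtlas h.mem_domChart_source
  let D : TangentSpace J' k →L[ℝ] TangentSpace J (f k) := mfderiv J' J f k
  have hAD : ∀ v, A (D v) = h.equiv (A' v, 0) := mfderiv_extend_immersion h
  have hker : LinearMap.ker (π₁.toLinearMap ∘ₗ A.toLinearMap) = LinearMap.range D.toLinearMap := by
    ext w
    constructor
    · intro hw
      have hw' : (h.equiv.symm (A w)).2 = 0 := (hπ₁0 _).1 hw
      obtain ⟨v, hv⟩ := hA'.2 (h.equiv.symm (A w)).1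
      refine ⟨v, hA.1 ?_⟩
      refine (hAD v).trans ?_
      rw [hv, ← hw', Prod.mk.eta, h.equiv.apply_symm_apply]
    · rintro ⟨v, rfl⟩
      change π₁ (A (D v)) = 0
      rw [hπ₁0, hAD, h.equiv.symm_apply_apply]
  have hfdK : FiniteDimensional ℝ (TangentSpace J' k) :=
    inferInstanceAs (FiniteDimensional ℝ (EuclideanSpace ℝ (Fin m)))
  have hfdM : FiniteDimensional ℝ (TangentSpace J (f k)) :=
    inferInstanceAs (FiniteDimensional ℝ (EuclideanSpace ℝ (Fin (m + 2))))
  obtain ⟨ε, hε, hsign⟩ := exists_sign_oriented D.toLinearMap (π₁.toLinearMap ∘ₗ A.toLinearMap)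
    (hπ₁s.comp hA.2) hker finrank_euclideanSpace_fin finrank_euclideanSpace_fin
    (oK.at_ k) (oM.at_ (f k))
  -- If the equation reverses the orientation of the normal space, complex conjugation repairs it.
  obtain ⟨C, hC1, hCI⟩ : ∃ C : ℂ ≃L[ℝ] ℂ, (∀ z, C z = 1 → z = 1) ∧
      ∀ z, C z = Complex.I → z = ε * Complex.I := by
    rcases hε with rfl | rfl
    · exact ⟨ContinuousLinearEquiv.refl ℝ ℂ, fun z hz => hz, fun z hz => by simpa using hz⟩
    · refine ⟨Complex.conjCLE, fun z hz => ?_, fun z hz => ?_⟩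
      · simpa using congrArg (starRingEnd ℂ) hz
      · simpa using congrArg (starRingEnd ℂ) hz
  let π : EuclideanSpace ℝ (Fin (m + 2)) →L[ℝ] ℂ := C.toContinuousLinearMap.comp π₁
  have hπ : ∀ y, π y = C (π₁ y) := fun y => rfl
  refine ⟨π, C.surjective.comp hπ₁s, fun y => by rw [hπ, C.map_eq_zero_iff, hπ₁0], ?_⟩
  intro V hVo hkV hVs hVz
  have hg : HasMFDerivAt J 𝓘(ℝ, ℂ) (fun x => π (h.codChart.extend J x)) (f k) (π.comp A) :=
    π.hasMFDerivAt.comp (f k) (mdifferentiableAt_extend h.codChart_mem_maximalAtlas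
      h.mem_codChart_source).hasMFDerivAt
  refine
    { isOpen := hVo
      mem := hkV
      smooth := π.contMDiff.comp_contMDiffOn
        ((h.codChart.contMDiffOn_extend h.codChart_mem_maximalAtlas).mono hVs)
      zero_iff := hVz
      surjective := ?_
      oriented := ?_ }
  · rw [hg.mfderiv]
    exact (C.surjective.comp hπ₁s).comp hA.2
  · rw [hg.mfderiv]
    intro b v₁ v₂ h₁ h₂
    exact hsign b v₁ v₂ (hC1 _ h₁) (hCI _ h₂)

/-- A small neighbourhood of a point of the submanifold has a path connected complement, in which
cocycles are detected by a meridian with linking number 1. -/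
lemma exists_meridian_neighbourhood (hJ : IsBoundaryModel J) (hJ' : IsBoundaryModel J')
    (oM : ManifoldOrientation J M) (oK : ManifoldOrientation J' K)
    (hf : IsProperlyEmbedded J J' f) (k : K) {W : Set M} (hW : W ∈ 𝓝 (f k))
    (Γ : Type*) [Group Γ] :
    ∃ V ⊆ W, IsOpen V ∧ f k ∈ V ∧
      PathCocycle.PreimagePathConnected (Subtype.val : ((range f)ᶜ : Set M) → M) V ∧
      ∃ (c : ((range f)ᶜ : Set M)) (β : Path c c),
        (∀ F : PathCocycle ((range f)ᶜ : Set M) Γ, F.val β = 1 → F.TrivialOver Subtype.val V) ∧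
        ∀ (p : M) (hp : p ∉ range f) (α : Path (⟨p, hp⟩ : ((range f)ᶜ : Set M)) c),
          ∃ q ∈ knotQuandle oM oK f p, augmentation (range f) p hp q =
            FundamentalGroup.fromPath
              (Path.Homotopic.Quotient.mk ((α.trans β).trans α.symm)) := by
  have h := hf.isSmoothEmbedding.isImmersion.isImmersionAt k
  obtain ⟨π, hπs, hπ0, hor⟩ := exists_linear_orientedEquation oM oK h
  have hy0 : π (h.codChart.extend J (f k)) = 0 := by
    rw [hπ0, extend_immersion h h.mem_domChart_source, h.equiv.symm_apply_apply]
  obtain ⟨s, hs, ε, hε, hsJ⟩ := exists_section_of_slice hJ hJ' hf h π hπs (fun u => by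
    rw [hπ0, h.equiv.symm_apply_apply])
  have hS : ∀ᶠ x in 𝓝 (f k), x ∈ range f ↔ π (h.codChart.extend J x) = 0 := by
    filter_upwards [eventually_mem_range_iff hJ hJ' hf h] with x hx
    rw [hx, hπ0]
  obtain ⟨V, hVW, hVo, hkV, hVs, B, δ, hyB, hB⟩ :=
    exists_isSliceChart h.codChart h.mem_codChart_source hW π s hs hy0 hε hsJ hS
  obtain ⟨c, β, D, w, hDc, hD1, hD0, hDS, hDβ, hw, hDV, hdet⟩ :=
    hB.exists_meridian (Γ := Γ) hyB hy0
  refine ⟨V, hVW, hVo, hkV, hB.preimagePathConnected ⟨_, hyB⟩, c, β, hdet, fun p hp α => ?_⟩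
  refine ⟨_, ⟨nooseOfArc α D hDc hD1 hDS, rfl, ?_⟩, augmentation_nooseOfArc α D hDc hD1 hDS β hDβ⟩
  have hlin : ∀ x ∈ V, π (h.codChart.extend J x) = 0 ↔ x ∈ range f := by
    intro x hx
    rw [← hB.mem_iff _ (hB.mapsTo_inv hx), hB.right_inv x hx]
  -- The whole disk lies in `V`, so the radius 1 is allowed. There the equation is `z ↦ z * w`,
  -- whose restriction to the circle has the explicit logarithm `2πit + log w`.
  refine ⟨k, V, fun x => π (h.codChart.extend J x), ?_, hor V hVo hkV hVs hlin, 1, one_pos, ?_, ?_⟩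
  · refine Eq.trans ?_ (nooseMap_center (α.map continuous_subtype_val) D hDc hD1).symm
    rw [hD0, h.codChart.extend_left_inv h.mem_codChart_source]
  · intro z hz
    have hz' : ‖(z : ℂ)‖ ≤ 1 := hz
    have h1 : nooseMap (α.map continuous_subtype_val) D hDc hD1 z = D z :=
      nooseMap_of_re_le _ _ _ _ ((Complex.re_le_norm _).trans hz')
    change nooseMap (α.map continuous_subtype_val) D hDc hD1 z ∈ V
    rw [h1]
    exact (hDV z hz').1
  · refine ⟨⟨fun t => 2 * Real.pi * Complex.I * (t : ℝ) + Complex.log w, by fun_prop⟩,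
      fun t => ?_, ?_⟩
    · have h1 : nooseMap (α.map continuous_subtype_val) D hDc hD1 (NooseSpace.diskPoint 1 t) =
          D (Complex.exp (2 * Real.pi * Complex.I * (t : ℝ))) := by
        refine (nooseMap_diskPoint (α.map continuous_subtype_val) D hDc hD1 1 t).trans ?_
        simp
      have h2 : ‖Complex.exp (2 * Real.pi * Complex.I * (t : ℝ))‖ ≤ 1 := by
        rw [Complex.norm_exp]
        simp
      change _ = π (h.codChart.extend J (nooseMap (α.map continuous_subtype_val) D hDc hD1
        (NooseSpace.diskPoint 1 t)))
      rw [h1, (hDV _ h2).2]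
      simp [Complex.exp_add, Complex.exp_log hw]
    · simp

end OrientedEquation

/-! ### The cocycle of a quotient of the fundamental group. -/

section Quotient

open Set

variable {A : Type*} [TopologicalSpace A]

lemma conj_trans_conj {p q r a b c : A} (x : Path.Homotopic.Quotient p a)
    (y : Path.Homotopic.Quotient q b) (z : Path.Homotopic.Quotient r c)
    (g : Path.Homotopic.Quotient a b) (h : Path.Homotopic.Quotient b c) :
    ((x.trans g).trans y.symm).trans ((y.trans h).trans z.symm) =
      (x.trans (g.trans h)).trans z.symm := by
  simp only [Path.Homotopic.Quotient.trans_assoc]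
  rw [← Path.Homotopic.Quotient.trans_assoc y.symm, Path.Homotopic.Quotient.symm_trans,
    Path.Homotopic.Quotient.refl_trans]

/-- The cocycle with values in a quotient of the fundamental group that is obtained by joining all
points to the base point. -/
def quotientCocycle {p : A} (N : Subgroup (FundamentalGroup A p)) [N.Normal]
    (r : ∀ a, Path p a) : PathCocycle A (FundamentalGroup A p ⧸ N) where
  -- The group law composes paths in the reverse order; the inverse turns concatenation into a
  -- product in the given order.
  val {a b} α := (QuotientGroup.mk (FundamentalGroup.fromPath
    (Path.Homotopic.Quotient.mk (((r a).trans α).trans (r b).symm))))⁻¹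
  val_trans {a b c} α β := by
    rw [← mul_inv_rev, ← QuotientGroup.mk_mul, FundamentalGroup.mul_def]
    congr 2
    exact (conj_trans_conj (Path.Homotopic.Quotient.mk (r a)) (Path.Homotopic.Quotient.mk (r b))
      (Path.Homotopic.Quotient.mk (r c)) (Path.Homotopic.Quotient.mk α)
      (Path.Homotopic.Quotient.mk β)).symm
  val_homotopic {a b α β} h := by
    congr 2
    simp only [Path.Homotopic.Quotient.mk_trans, Path.Homotopic.Quotient.eq.2 h]

lemma quotientCocycle_val_eq_one_iff {p : A} (N : Subgroup (FundamentalGroup A p)) [N.Normal]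
    (r : ∀ a, Path p a) {a : A} (α : Path a a) :
    (quotientCocycle N r).val α = 1 ↔ FundamentalGroup.fromPath
      (Path.Homotopic.Quotient.mk (((r a).trans α).trans (r a).symm)) ∈ N := by
  rw [← QuotientGroup.eq_one_iff]
  exact inv_eq_one

/-- Conjugation only replaces the arc `x` by the inverse of `d` followed by `x`. So the loops that
run around a fixed `b`, with all arcs allowed, are closed under conjugation. -/
lemma conj_mul_conj_inv {p c : A} (d : FundamentalGroup A p) (x : Path.Homotopic.Quotient p c)
    (b : Path.Homotopic.Quotient c c) :
    d * FundamentalGroup.fromPath ((x.trans b).trans x.symm) * d⁻¹ =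
      FundamentalGroup.fromPath ((((Path.Homotopic.Quotient.symm d).trans x).trans b).trans
        ((Path.Homotopic.Quotient.symm d).trans x).symm) := by
  induction d using Path.Homotopic.Quotient.ind with | mk d =>
  rw [FundamentalGroup.mul_def, FundamentalGroup.mul_def, FundamentalGroup.inv_def]
  have h : ((Path.Homotopic.Quotient.mk d).symm.trans x).symm =
      x.symm.trans (Path.Homotopic.Quotient.mk d) := by
    induction x using Path.Homotopic.Quotient.ind with | mk x =>
    simp only [← Path.Homotopic.Quotient.mk_symm, ← Path.Homotopic.Quotient.mk_trans,
      Path.trans_symm, Path.symm_symm]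
  rw [h]
  simp only [Path.Homotopic.Quotient.trans_assoc]

end Quotient

/-! ### Generation of the fundamental group by the knot quandle. -/

section Generation

variable {m : ℕ} {H H' : Type*} [TopologicalSpace H] [TopologicalSpace H']
  {J : ModelWithCorners ℝ (EuclideanSpace ℝ (Fin (m + 2))) H}
  {J' : ModelWithCorners ℝ (EuclideanSpace ℝ (Fin m)) H'}
  {M : Type*} [TopologicalSpace M] [ChartedSpace H M] [IsManifold J ∞ M]
  {K : Type*} [TopologicalSpace K] [ChartedSpace H' K] [IsManifold J' ∞ K]

/-- The augmentation maps the knot quandle to a set of generators of the fundamental group of the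
complement. -/
theorem closure_augmentation_image_knotQuandle (hJ : IsBoundaryModel J)
    (hJ' : IsBoundaryModel J') (oM : ManifoldOrientation J M) (oK : ManifoldOrientation J' K)
    {f : K → M} (hf : IsProperlyEmbedded J J' f) {p : M} (hp : p ∉ Set.range f)
    [SimplyConnectedSpace M] :
    Subgroup.closure (augmentation (Set.range f) p hp '' knotQuandle oM oK f p) = ⊤ := by
  let A : Type _ := ((Set.range f)ᶜ : Set M)
  -- The loop `β` must give an element of the quandle for every arc to `c`, not just for `α`; then
  -- conjugates of elements of `R` come from the quandle too.
  let R : Set (FundamentalGroup A ⟨p, hp⟩) := {g | ∃ (c : A) (β : Path c c)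
    (α : Path (⟨p, hp⟩ : A) c), (∀ α' : Path (⟨p, hp⟩ : A) c,
      ∃ q ∈ knotQuandle oM oK f p, augmentation (Set.range f) p hp q =
        FundamentalGroup.fromPath
          (Path.Homotopic.Quotient.mk ((α'.trans β).trans α'.symm))) ∧
    g = FundamentalGroup.fromPath (Path.Homotopic.Quotient.mk ((α.trans β).trans α.symm))}
  have hR : Subgroup.normalClosure R ≤ Subgroup.closure
      (augmentation (Set.range f) p hp '' knotQuandle oM oK f p) := by
    refine (Subgroup.closure_le _).2 fun g hg => ?_
    obtain ⟨_, ⟨c, β, α, hβ, rfl⟩, hconj⟩ := Group.mem_conjugatesOfSet_iff.1 hg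
    obtain ⟨d, rfl⟩ := isConj_iff.1 hconj
    obtain ⟨δ, rfl⟩ := Path.Homotopic.Quotient.mk_surjective d
    obtain ⟨q, hq, hqe⟩ := hβ (δ.symm.trans α)
    refine Subgroup.subset_closure ⟨q, hq, hqe.trans ?_⟩
    exact (conj_mul_conj_inv (Path.Homotopic.Quotient.mk δ) (Path.Homotopic.Quotient.mk α)
      (Path.Homotopic.Quotient.mk β)).symm
  have hclosed : IsClosed (Set.range f) := hf.isProperMap.isClosedMap.isClosed_range
  have hlpc : LocallyPathConnectedSpace M := locallyPathConnectedSpace_of_chartedSpace J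
  have hlocal : ∀ (Γ : Type _) [Group Γ] (F : PathCocycle A Γ),
      (∀ (c : A) (β : Path c c), (∀ α' : Path (⟨p, hp⟩ : A) c,
        ∃ q ∈ knotQuandle oM oK f p, augmentation (Set.range f) p hp q =
          FundamentalGroup.fromPath
            (Path.Homotopic.Quotient.mk ((α'.trans β).trans α'.symm))) → F.val β = 1) →
      ∀ x : M, ∀ W ∈ 𝓝 x, ∃ V ⊆ W, IsOpen V ∧ x ∈ V ∧
        PathCocycle.PreimagePathConnected (Subtype.val : A → M) V ∧
          F.TrivialOver Subtype.val V := by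
    intro Γ _ F hF x W hW
    by_cases hx : x ∈ Set.range f
    · obtain ⟨k, rfl⟩ := hx
      obtain ⟨V, hVW, hVo, hkV, hVc, c, β, hdet, hq⟩ :=
        exists_meridian_neighbourhood hJ hJ' oM oK hf k hW Γ
      exact ⟨V, hVW, hVo, hkV, hVc, hdet F (hF c β fun α' => hq p hp α')⟩
    · exact exists_trivialOver_of_notMem J hclosed hx hW F
  have hpc : PathConnectedSpace A := by
    -- A dummy cocycle: only the neighbourhoods supplied by `hlocal` matter here.
    let F₀ : PathCocycle A PUnit :=
      { val := fun _ => 1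
        val_trans := fun _ _ => rfl
        val_homotopic := fun _ => rfl }
    refine PathCocycle.pathConnectedSpace_of_basis (i := (Subtype.val : A → M))
      fun x W hW => ?_
    obtain ⟨V, hVW, hVo, hxV, hVc, -⟩ := hlocal PUnit F₀ (fun _ _ _ => rfl) x W hW
    exact ⟨V, hVW, hVo, hxV, hVc⟩
  let r : ∀ a : A, Path (⟨p, hp⟩ : A) a := fun a => PathConnectedSpace.somePath _ a
  let F := quotientCocycle (Subgroup.normalClosure R) r
  have hF : ∀ γ : Path (⟨p, hp⟩ : A) ⟨p, hp⟩, F.val γ = 1 := fun γ =>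
    PathCocycle.val_eq_one_of_locally_trivial (i := (Subtype.val : A → M))
      continuous_subtype_val (hlocal _ F fun c β hβ =>
        (quotientCocycle_val_eq_one_iff _ _ _).2
          (Subgroup.subset_normalClosure ⟨c, β, r c, hβ, rfl⟩)) γ
  refine eq_top_iff.2 fun g _ => hR ?_
  obtain ⟨γ, rfl⟩ := Path.Homotopic.Quotient.mk_surjective g
  -- The chosen path from `p` to itself need not be constant. Conjugating `γ` by it beforehand
  -- cancels the conjugation built into the cocycle.
  have h := (quotientCocycle_val_eq_one_iff _ _ _).1 (hF (((r _).symm.trans γ).trans (r _)))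
  convert h using 1
  simp only [Path.Homotopic.Quotient.mk_trans, Path.Homotopic.Quotient.mk_symm]
  generalize Path.Homotopic.Quotient.mk (r ⟨p, hp⟩) = x
  generalize Path.Homotopic.Quotient.mk γ = y
  rw [← Path.Homotopic.Quotient.trans_assoc, ← Path.Homotopic.Quotient.trans_assoc]
  simp

end Generation

end KnotQuandle

end

theorem proposition10 {m : ℕ}
    {H : Type*} [TopologicalSpace H]
    (J : ModelWithCorners ℝ (EuclideanSpace ℝ (Fin (m + 2))) H)
    (hJ : KnotQuandle.IsBoundaryModel J)
    {H' : Type*} [TopologicalSpace H']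
    (J' : ModelWithCorners ℝ (EuclideanSpace ℝ (Fin m)) H')
    (hJ' : KnotQuandle.IsBoundaryModel J')
    {M : Type*} [TopologicalSpace M] [T2Space M] [SecondCountableTopology M]
    [ChartedSpace H M] [IsManifold J ∞ M]
    {K : Type*} [TopologicalSpace K] [ChartedSpace H' K] [IsManifold J' ∞ K]
    (oM : KnotQuandle.ManifoldOrientation J M) (oK : KnotQuandle.ManifoldOrientation J' K)
    (f : K → M) (hf : KnotQuandle.IsProperlyEmbedded J J' f)
    (p : M) (hp : p ∉ Set.range f)
    [SimplyConnectedSpace M] :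
    Subgroup.closure
        (KnotQuandle.augmentation (Set.range f) p hp '' KnotQuandle.knotQuandle oM oK f p) =
      (⊤ : Subgroup (FundamentalGroup ((Set.range f)ᶜ : Set M) ⟨p, hp⟩)) :=
  KnotQuandle.closure_augmentation_image_knotQuandle hJ hJ' oM oK hf hp
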